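/- **Definitions.** An *order-unit space* is a real partially ordered vector space $A$ with a distinguished element $e>0$ such that for each $a\in A$ there is $r\in\mathbb R$ with $a\le re$, and such that $a\le re$ for all real $r>0$ implies $a\le 0$. Its norm is $\|a\|=\inf\{r\in\mathbb R:-re\le a\le re\}$. Its state space $S(A)$ is the set of bounded linear functionals $\mu$ on $A$ with $\mu(e)=1=\|\mu\|'$, where $\|\cdot\|'$ is the dual norm. For a seminorm $L$ on $A$ put $\rho_L(\mu,\nu)=\sup\{|\mu(a)-\nu(a)|:L(a)\le 1\}$ for $\mu,\nu\in S(A)$. A *Lip-norm* is a seminorm $L$ on $A$ such that $L(a)=0$ iff $a\in\mathbb Re$, and such that the topology of $\rho_L$ on $S(A)$ is the weak-$*$ topology. A *compact quantum metric space* is a pair $(A,L)$ of an order-unit space $A$ and a Lip-norm $L$ on it; $\mathrm{diam}(A,L)$ is the diameter of $(S(A),\rho_L)$. For compact quantum metric spaces $(A,L_A)$ and $(B,L_B)$, equip $A\oplus B$ with the componentwise order and the order unit $(e_A,e_B)$, and view $S(A)$ and $S(B)$ as subsets of $S(A\oplus B)$ via the coordinate projections. The *quantum Gromov–Hausdorff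 distance* $\mathrm{dist}_q(A,B)$ is the infimum of the Hausdorff distances $\mathrm{dist}_H^{\rho_L}(S(A),S(B))$ over all Lip-norms $L$ on $A\oplus B$ with $L_A(a)=\inf_{b\in B}L(a,b)$ for all $a \in A$ and $L_B(b)=\inf_{a\in A}L(a,b)$ for all $b \in B$. A set $\mathcal S$ of compact quantum metric spaces is *totally bounded* for $\mathrm{dist}_q$ if for every $\varepsilon>0$ there are finitely many compact quantum metric spaces such that each member of $\mathcal S$ is at $\mathrm{dist}_q$-distance less than $\varepsilon$ from one of them. For $\varepsilon>0$ let $\mathrm{Fin}_L(\varepsilon)$ be the smallest integer $n$ such that there is a compact quantum metric space $(B,L_B)$ with $\mathrm{dist}_q(A,B)<\varepsilon$ and $\dim B\le n$, and let $\mathrm{Scv}_L(\varepsilon)$ be the smallest integer $n$ such that there is a subset $F$ of $S(A)$ with $n$ elements such that every point of $S(A)$ is at $\rho_L$-distance less than $\varepsilon$ from some point of $F$. **Theorem 13.5 (Quantum Gromov compactness theorem).** Let $\mathcal S$ be a set of compact quantum metric spaces. If $\mathcal S$ is totally bounded for $\mathrm{dist}_q$, then 1. there is a constant $D$ such that $\mathrm{diam}(A,L)\le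 D$ for all $(A,L)\in\mathcal S$; and 2. there is a function $G:\mathbb R^+\to\mathbb N^+$ such that $G(\varepsilon)\ge \mathrm{Scv}_L(\varepsilon)\ \,(\ge \mathrm{Fin}_L(\varepsilon))$ for every $(A,L)\in\mathcal S$ and every $\varepsilon>0$. Conversely, if 1. there is a constant $D$ such that $\mathrm{diam}(A,L)\le D$ for all $(A,L)\in\mathcal S$; and 2. there is a function $G:\mathbb R^+\to\mathbb N^+$ such that $G(\varepsilon)\ge \mathrm{Fin}_L(\varepsilon)$ for every $(A,L)\in\mathcal S$ and every $\varepsilon>0$, then $\mathcal S$ is totally bounded for $\mathrm{dist}_q$. -/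

import Mathlib

open scoped ENNReal NNReal

universe u

noncomputable section

/-- An order-unit space: a real partially ordered vector space with a distinguished strictly
positive element `unit` having the order unit property and the Archimedean property. -/
class OrderUnitSpace (A : Type*) [AddCommGroup A] [PartialOrder A] [Module ℝ A] : Type _
    extends IsOrderedAddMonoid A, PosSMulMono ℝ A where
  unit : A
  unit_pos : 0 < unit
  exists_le_smul_unit : ∀ a : A, ∃ r : ℝ, a ≤ r • unit
  archimedean : ∀ a : A, (∀ r : ℝ, 0 < r → a ≤ r • unit) → a ≤ 0

/-- The direct sum of two order-unit spaces, with the componentwise order and the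
order unit `(e_A, e_B)`. -/
instance OrderUnitSpace.prod {A B : Type*}
    [AddCommGroup A] [PartialOrder A] [Module ℝ A] [OrderUnitSpace A]
    [AddCommGroup B] [PartialOrder B] [Module ℝ B] [OrderUnitSpace B] :
    OrderUnitSpace (A × B) where
  smul_le_smul_of_nonneg_left r hr _ _ h :=
    ⟨smul_le_smul_of_nonneg_left h.1 hr, smul_le_smul_of_nonneg_left h.2 hr⟩
  unit := (unit, unit)
  unit_pos := Prod.mk_lt_mk.2 (Or.inl ⟨unit_pos, unit_pos.le⟩)
  exists_le_smul_unit x := by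
    obtain ⟨r, hr⟩ := exists_le_smul_unit x.1
    obtain ⟨s, hs⟩ := exists_le_smul_unit x.2
    exact ⟨max r s,
      hr.trans (smul_le_smul_of_nonneg_right (le_max_left r s) unit_pos.le),
      hs.trans (smul_le_smul_of_nonneg_right (le_max_right r s) unit_pos.le)⟩
  archimedean x h :=
    ⟨archimedean x.1 fun r hr => (h r hr).1, archimedean x.2 fun r hr => (h r hr).2⟩

section OrderUnitSpaceDefs

variable (A : Type*) [AddCommGroup A] [PartialOrder A] [Module ℝ A] [OrderUnitSpace A]

/-- The order-unit norm `‖a‖ = inf {r | -re ≤ a ≤ re}`. -/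
def orderUnitNorm {A : Type*} [AddCommGroup A] [PartialOrder A] [Module ℝ A] [OrderUnitSpace A]
    (a : A) : ℝ :=
  sInf {r : ℝ | -(r • (OrderUnitSpace.unit : A)) ≤ a ∧ a ≤ r • (OrderUnitSpace.unit : A)}

/-- The state space `S(A)`: the bounded linear functionals `μ` with `μ(e) = 1 = ‖μ‖'`, where
`‖μ‖' = sup {|μ(a)| : ‖a‖ ≤ 1}` is the dual norm. -/
def StateSpace : Type _ :=
  {μ : A →ₗ[ℝ] ℝ // μ OrderUnitSpace.unit = 1 ∧
    IsLUB {t : ℝ | ∃ a : A, orderUnitNorm a ≤ 1 ∧ t = |μ a|} 1}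

instance : CoeFun (StateSpace A) (fun _ => A → ℝ) := ⟨fun μ => μ.1⟩

/-- The `w*`-topology on the state space: the coarsest topology for which `μ ↦ μ(a)` is
continuous for every `a`. -/
abbrev weakStarTopology : TopologicalSpace (StateSpace A) :=
  TopologicalSpace.induced (fun (μ : StateSpace A) (a : A) => μ a) Pi.topologicalSpace

end OrderUnitSpaceDefs

section LipNorms

variable {A : Type*} [AddCommGroup A] [PartialOrder A] [Module ℝ A] [OrderUnitSpace A]

/-- The metric `ρ_L(μ, ν) = sup {|μ(a) - ν(a)| : L(a) ≤ 1}` on the state space; for a general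
seminorm it may take the value `∞`. -/
def rho (L : Seminorm ℝ A) (μ ν : StateSpace A) : ℝ≥0∞ :=
  ⨆ (a : A) (_ : L a ≤ 1), ENNReal.ofReal |μ a - ν a|

/-- The state space as a (pseudo-, extended) metric space for `ρ_L`, with the topology
of `ρ_L`. -/
abbrev rhoMetric (L : Seminorm ℝ A) : PseudoEMetricSpace (StateSpace A) where
  edist := rho L
  edist_self μ := by simp [rho]
  edist_comm μ ν := by simp only [rho, abs_sub_comm]
  edist_triangle μ ν κ := by
    refine iSup₂_le fun a ha => ?_
    calc ENNReal.ofReal |μ a - κ a|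
        ≤ ENNReal.ofReal (|μ a - ν a| + |ν a - κ a|) :=
          ENNReal.ofReal_le_ofReal (abs_sub_le _ _ _)
      _ = ENNReal.ofReal |μ a - ν a| + ENNReal.ofReal |ν a - κ a| :=
          ENNReal.ofReal_add (abs_nonneg _) (abs_nonneg _)
      _ ≤ rho L μ ν + rho L ν κ :=
          add_le_add
            (le_iSup₂ (f := fun (a : A) (_ : L a ≤ 1) => ENNReal.ofReal |μ a - ν a|) a ha)
            (le_iSup₂ (f := fun (a : A) (_ : L a ≤ 1) => ENNReal.ofReal |ν a - κ a|) a ha)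

/-- A Lip-norm: a seminorm which vanishes exactly on `ℝe` and whose metric `ρ_L` gives the
`w*`-topology on the state space. -/
structure IsLipNorm (L : Seminorm ℝ A) : Prop where
  eq_zero_iff : ∀ a : A, L a = 0 ↔ ∃ t : ℝ, a = t • (OrderUnitSpace.unit : A)
  topology_eq : (rhoMetric L).toUniformSpace.toTopologicalSpace = weakStarTopology A

variable {B : Type*} [AddCommGroup B] [PartialOrder B] [Module ℝ B] [OrderUnitSpace B]

/-- `L` induces `L_B` along the surjection `π`: `L_B(b) = inf {L(a) : π(a) = b}`. -/
def Induces (L : Seminorm ℝ A) (π : A →ₗ[ℝ] B) (LB : Seminorm ℝ B) : Prop :=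
  ∀ b : B, IsGLB {t : ℝ | ∃ a : A, π a = b ∧ t = L a} (LB b)

/-- `S(B)` viewed as a subset of `S(A)` through a morphism `π` of `A` onto `B`: the set of all
states `μ ∘ π` with `μ ∈ S(B)`. -/
def stateImage (π : A →ₗ[ℝ] B) : Set (StateSpace A) :=
  {σ | ∃ μ : StateSpace B, ∀ a : A, σ a = μ (π a)}

end LipNorms

/-- A compact quantum metric space: an order-unit space with a Lip-norm. -/
structure CompactQuantumMetricSpace : Type (u + 1) where
  carrier : Type u
  [addCommGroup : AddCommGroup carrier]
  [partialOrder : PartialOrder carrier]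
  [module : Module ℝ carrier]
  [orderUnitSpace : OrderUnitSpace carrier]
  lip : Seminorm ℝ carrier
  isLipNorm : IsLipNorm lip

namespace CompactQuantumMetricSpace

attribute [instance] addCommGroup partialOrder module orderUnitSpace

/-- The set `𝓜(L_A, L_B)` of Lip-norms on `A ⊕ B` which induce `L_A` and `L_B`. -/
def lipNorms (X Y : CompactQuantumMetricSpace.{u}) : Set (Seminorm ℝ (X.carrier × Y.carrier)) :=
  {L | IsLipNorm L ∧ Induces L (LinearMap.fst ℝ X.carrier Y.carrier) X.lip ∧
    Induces L (LinearMap.snd ℝ X.carrier Y.carrier) Y.lip}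

/-- The quantum Gromov–Hausdorff distance: the infimum over `L ∈ 𝓜(L_A, L_B)` of the Hausdorff
distance for `ρ_L` between `S(A)` and `S(B)` in `S(A ⊕ B)`. -/
def distq (X Y : CompactQuantumMetricSpace.{u}) : ℝ≥0∞ :=
  ⨅ L ∈ lipNorms X Y,
    @Metric.hausdorffEDist _ (rhoMetric L)
      (stateImage (LinearMap.fst ℝ X.carrier Y.carrier))
      (stateImage (LinearMap.snd ℝ X.carrier Y.carrier))

/-- The diameter of `(A, L)`, that is, of the metric space `(S(A), ρ_L)`. -/
def diam (X : CompactQuantumMetricSpace.{u}) : ℝ≥0∞ :=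
  @Metric.ediam _ (rhoMetric X.lip) Set.univ

/-- `Fin_L(ε)`: the smallest `n` such that some compact quantum metric space of vector space
dimension at most `n` is at quantum distance less than `ε` from `(A, L)`. -/
def fin (X : CompactQuantumMetricSpace.{u}) (ε : ℝ) : ℕ∞ :=
  ⨅ (n : ℕ) (_ : ∃ Y : CompactQuantumMetricSpace.{u},
    distq X Y < ENNReal.ofReal ε ∧ Module.rank ℝ Y.carrier ≤ n), (n : ℕ∞)

/-- `Scv_L(ε)`: the smallest `n` such that some subset of `S(A)` with `n` elements is
`ε`-dense in `S(A)` for `ρ_L`. -/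
def scv (X : CompactQuantumMetricSpace.{u}) (ε : ℝ) : ℕ∞ :=
  ⨅ (n : ℕ) (_ : ∃ F : Finset (StateSpace X.carrier), F.card = n ∧
    ∀ μ : StateSpace X.carrier, ∃ ν ∈ F, rho X.lip μ ν < ENNReal.ofReal ε), (n : ℕ∞)

/-- Total boundedness for the quantum Gromov–Hausdorff distance. -/
def IsTotallyBounded (S : Set CompactQuantumMetricSpace.{u}) : Prop :=
  ∀ ε : ℝ, 0 < ε → ∃ F : Set CompactQuantumMetricSpace.{u}, F.Finite ∧
    ∀ X ∈ S, ∃ Y ∈ F, distq X Y < ENNReal.ofReal ε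

end CompactQuantumMetricSpace

end

/-! The main tool is a criterion for Lip-norms that avoids topology. A seminorm vanishing at the
unit is a Lip-norm as soon as its unit ball splits into finitely many pieces on which differences
have small oscillation over the state space (`OscTotallyBounded`), and every Lip-norm has this
property. The criterion passes to quotients and to glued seminorms. This gives the triangle
inequality `distq_lt_add` and lets explicit maxima of seminorms on a direct sum serve as Lip-norms
(`distq_le_of_bridge`).

Total boundedness implies the bounds: if `X` is close to `Y`, states of the two spaces can be
matched through a Lip-norm on the sum, so a diameter bound or a finite net of states of `Y`
transfers to `X` with a small loss. Finitely many centres `Y` then give uniform constants. The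
inequality `fin_le_scv` comes from restricting the elements of `X` to a finite net of states: the
resulting quotient has dimension at most the size of the net, and its states, pulled back to `X`,
come close to every state of `X`.

Conversely, bounds on `fin` replace each member of the family by a nearby space of bounded dimension
whose diameter is still bounded. Modulo the unit, an Auerbach basis places the Lip-norm between the
`ℓ^∞` and `ℓ¹` norms on `ℝ^k`. The Lip-norm is therefore uniformly Lipschitz in these coordinates,
and the states become points of a bounded cube. Rounding the values of the Lip-norm on a finite net,
and recording which small cells of the cube contain states, leaves finitely many possibilities.
Spaces with the same record are close by a bridge, so one representative per record suffices. -/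

noncomputable section

/-! ### Order-unit norm and one-sided bounds. -/

namespace OrderUnitSpace

section Basic

variable {A : Type*} [AddCommGroup A] [PartialOrder A] [Module ℝ A] [OrderUnitSpace A]

lemma smul_unit_nonneg_iff {r : ℝ} : 0 ≤ r • (unit : A) ↔ 0 ≤ r := by
  refine ⟨fun h => ?_, fun h => smul_nonneg h unit_pos.le⟩
  by_contra! hr
  have h1 : (-r)⁻¹ • (r • (unit : A)) = -unit := by
    rw [smul_smul, inv_neg, neg_mul, inv_mul_cancel₀ hr.ne, neg_one_smul]
  have h2 : 0 ≤ (-r)⁻¹ • (r • (unit : A)) := smul_nonneg (inv_nonneg.2 (by linarith)) h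
  rw [h1] at h2
  exact absurd unit_pos (not_lt_of_ge (neg_nonneg.1 h2))

lemma smul_unit_le_smul_unit_iff {r s : ℝ} : r • (unit : A) ≤ s • unit ↔ r ≤ s := by
  rw [← sub_nonneg, ← sub_smul, smul_unit_nonneg_iff, sub_nonneg]

lemma neg_smul_unit_le_iff {a : A} {r : ℝ} : -(r • unit) ≤ a ↔ -a ≤ r • unit := by
  rw [neg_le]

lemma le_smul_unit_of_forall_lt {a : A} {r : ℝ} (h : ∀ s, r < s → a ≤ s • unit) :
    a ≤ r • unit := by
  rw [← sub_nonpos]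
  refine archimedean _ fun δ hδ => ?_
  rw [sub_le_iff_le_add, ← add_smul]
  exact h _ (by linarith)

lemma unit_mem_range_bddBelow (a : A) : BddBelow {r : ℝ | a ≤ r • unit} := by
  obtain ⟨s, hs⟩ := exists_le_smul_unit (-a)
  refine ⟨-s, fun r hr => ?_⟩
  have : (-s) • (unit : A) ≤ r • unit := by
    rw [neg_smul]; exact (neg_le.1 hs).trans hr
  exact smul_unit_le_smul_unit_iff.1 this

/-- The least `r` with `a ≤ r e`. -/
def upper (a : A) : ℝ := sInf {r : ℝ | a ≤ r • unit}

lemma upper_le_iff {a : A} {r : ℝ} : upper a ≤ r ↔ a ≤ r • unit := by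
  refine ⟨fun h => le_smul_unit_of_forall_lt fun s hs => ?_,
    fun h => csInf_le (unit_mem_range_bddBelow a) h⟩
  obtain ⟨t, ht, hts⟩ := exists_lt_of_csInf_lt (exists_le_smul_unit a) (h.trans_lt hs)
  exact le_trans ht (smul_unit_le_smul_unit_iff.2 hts.le)

lemma le_upper_smul_unit (a : A) : a ≤ upper a • unit := upper_le_iff.1 le_rfl

lemma upper_add_le (a b : A) : upper (a + b) ≤ upper a + upper b := by
  rw [upper_le_iff, add_smul]
  exact add_le_add (le_upper_smul_unit a) (le_upper_smul_unit b)

lemma upper_smul_le {c : ℝ} (hc : 0 ≤ c) (a : A) : upper (c • a) ≤ c * upper a := by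
  rw [upper_le_iff, mul_smul]
  exact smul_le_smul_of_nonneg_left (le_upper_smul_unit a) hc

lemma upper_smul {c : ℝ} (hc : 0 < c) (a : A) : upper (c • a) = c * upper a := by
  refine (upper_smul_le hc.le a).antisymm ?_
  have := upper_smul_le (inv_nonneg.2 hc.le) (c • a)
  rw [smul_smul, inv_mul_cancel₀ hc.ne', one_smul] at this
  rwa [← le_inv_mul_iff₀ hc]

lemma upper_smul_unit (r : ℝ) : upper (r • unit : A) = r := by
  refine (upper_le_iff.2 le_rfl).antisymm ?_
  exact smul_unit_le_smul_unit_iff.1 (le_upper_smul_unit (r • unit : A))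

lemma orderUnitNorm_le_iff {a : A} {r : ℝ} :
    orderUnitNorm a ≤ r ↔ -(r • unit) ≤ a ∧ a ≤ r • unit := by
  have hbdd : BddBelow {r : ℝ | -(r • (unit : A)) ≤ a ∧ a ≤ r • (unit : A)} :=
    (unit_mem_range_bddBelow a).mono fun r hr => hr.2
  have hne : {r : ℝ | -(r • (unit : A)) ≤ a ∧ a ≤ r • (unit : A)}.Nonempty := by
    refine ⟨max (upper a) (upper (-a)), ?_, upper_le_iff.1 (le_max_left _ _)⟩
    exact neg_smul_unit_le_iff.2 (upper_le_iff.1 (le_max_right _ _))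
  refine ⟨fun h => ?_, fun h => csInf_le hbdd h⟩
  have key : ∀ s, r < s → -(s • unit) ≤ a ∧ a ≤ s • unit := by
    intro s hs
    obtain ⟨t, ht, hts⟩ := exists_lt_of_csInf_lt hne (h.trans_lt hs)
    have := smul_unit_le_smul_unit_iff (A := A).2 hts.le
    exact ⟨(neg_le_neg this).trans ht.1, ht.2.trans this⟩
  rw [neg_smul_unit_le_iff]
  exact ⟨le_smul_unit_of_forall_lt fun s hs => neg_smul_unit_le_iff.1 (key s hs).1,
    le_smul_unit_of_forall_lt fun s hs => (key s hs).2⟩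

end Basic

end OrderUnitSpace

/-! ### States: positivity, Hahn–Banach, weak-* compactness. -/

namespace StateSpace

open OrderUnitSpace

variable {A : Type*} [AddCommGroup A] [PartialOrder A] [Module ℝ A] [OrderUnitSpace A]

lemma map_unit (μ : StateSpace A) : μ unit = 1 := μ.2.1

lemma map_smul_unit (μ : StateSpace A) (r : ℝ) : μ (r • unit) = r := by
  rw [map_smul, map_unit, smul_eq_mul, mul_one]

/-- If `0 ≤ a ≤ r e`, then `e - a / r` has norm at most `1`, so a state takes a value at most `1`
there; since its value at `e` is `1`, this forces `μ a ≥ 0`. -/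
lemma map_nonneg (μ : StateSpace A) {a : A} (ha : 0 ≤ a) : 0 ≤ μ a := by
  obtain ⟨r, hr, har⟩ : ∃ r : ℝ, 0 < r ∧ a ≤ r • unit := by
    refine ⟨max (upper a) 1, by positivity, upper_le_iff.1 (le_max_left _ _)⟩
  have h1 : r⁻¹ • a ≤ unit := by
    have := smul_le_smul_of_nonneg_left har (inv_nonneg.2 hr.le)
    rwa [smul_smul, inv_mul_cancel₀ hr.ne', one_smul] at this
  have h2 : orderUnitNorm (unit - r⁻¹ • a) ≤ 1 := by
    rw [orderUnitNorm_le_iff, one_smul]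
    refine ⟨(neg_nonpos.2 unit_pos.le).trans (sub_nonneg.2 h1), ?_⟩
    exact sub_le_self _ (smul_nonneg (inv_nonneg.2 hr.le) ha)
  have h3 := μ.2.2.1 ⟨_, h2, rfl⟩
  rw [map_sub, map_smul, map_unit, smul_eq_mul] at h3
  have h4 := (abs_le.1 h3).2
  have h5 : 0 ≤ r⁻¹ * μ a := by linarith
  exact (mul_nonneg_iff_of_pos_left (inv_pos.2 hr)).1 h5

lemma mono (μ : StateSpace A) {a b : A} (h : a ≤ b) : μ a ≤ μ b := by
  have := μ.map_nonneg (sub_nonneg.2 h)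
  rwa [map_sub, sub_nonneg] at this

/-- A positive linear functional taking the value `1` at the order unit is a state. -/
def ofPositive (f : A →ₗ[ℝ] ℝ) (h1 : f unit = 1) (h0 : ∀ a, 0 ≤ a → 0 ≤ f a) : StateSpace A := by
  refine ⟨f, h1, ?_, fun t ht => ht ⟨unit, ?_, by simp [h1]⟩⟩
  · rintro t ⟨a, ha, rfl⟩
    rw [orderUnitNorm_le_iff, one_smul] at ha
    have h2 := h0 _ (sub_nonneg.2 ha.1)
    have h3 := h0 _ (sub_nonneg.2 ha.2)
    simp only [map_sub, map_neg, h1] at h2 h3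
    exact abs_le.2 ⟨by linarith, by linarith⟩
  · rw [orderUnitNorm_le_iff, one_smul]
    exact ⟨(neg_nonpos.2 unit_pos.le).trans unit_pos.le, le_rfl⟩

@[simp] lemma ofPositive_apply (f : A →ₗ[ℝ] ℝ) (h1 : f unit = 1) (h0 : ∀ a, 0 ≤ a → 0 ≤ f a)
    (a : A) : ofPositive f h1 h0 a = f a := rfl

/-- Hahn–Banach: the bound `upper a` is attained at some state. -/
lemma exists_apply_eq_upper (a : A) : ∃ μ : StateSpace A, μ a = upper a := by
  have hzero : upper (0 : A) = 0 := by simpa using upper_smul_unit (A := A) 0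
  have hunit : upper (unit : A) = 1 := by simpa using upper_smul_unit (A := A) 1
  have hneg : upper (-unit : A) = -1 := by simpa using upper_smul_unit (A := A) (-1)
  have key : ∀ a : A, a ≠ 0 → ∃ μ : StateSpace A, μ a = upper a := by
    intro a ha
    have hsum : 0 ≤ upper a + upper (-a) := by
      have := upper_add_le a (-a)
      rwa [add_neg_cancel, hzero] at this
    obtain ⟨g, hga, hg⟩ := exists_extension_of_le_sublinear
      (LinearPMap.mkSpanSingleton a (upper a) ha : A →ₗ.[ℝ] ℝ) upper
      (fun c hc x => upper_smul hc x) upper_add_le (by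
        rintro ⟨x, hx⟩
        obtain ⟨c, rfl⟩ := Submodule.mem_span_singleton.1 hx
        refine (LinearPMap.mkSpanSingleton'_apply _ _ _ c hx).trans_le ?_
        rw [RingHom.id_apply, smul_eq_mul]
        rcases lt_trichotomy c 0 with hc | rfl | hc
        · have : upper (c • a) = (-c) * upper (-a) := by
            rw [← upper_smul (by linarith), smul_neg, neg_smul, neg_neg]
          rw [this]; nlinarith
        · simp [hzero]
        · exact (upper_smul hc a).ge)
    -- Domination by `upper` at both `e` and `-e` pins `g e = 1`; domination at `-x` gives
    -- positivity.
    have h1 := hg unit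
    have h2 := hg (-unit)
    rw [map_neg] at h2
    refine ⟨ofPositive g (by linarith) fun x hx => ?_, ?_⟩
    · have h3 := hg (-x)
      have h4 : upper (-x) ≤ 0 := upper_le_iff.2 (by simpa using hx)
      rw [map_neg] at h3
      linarith
    · have := hga ⟨a, Submodule.mem_span_singleton_self a⟩
      rw [ofPositive_apply, this]
      exact LinearPMap.mkSpanSingleton_apply ℝ ℝ ha (upper a)
  by_cases ha : a = 0
  · obtain ⟨μ, -⟩ := key unit unit_pos.ne'
    exact ⟨μ, by rw [ha, hzero, map_zero]⟩
  · exact key a ha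

instance : Nonempty (StateSpace A) := ⟨(exists_apply_eq_upper (0 : A)).choose⟩

lemma le_smul_unit_iff {a : A} {r : ℝ} : a ≤ r • unit ↔ ∀ μ : StateSpace A, μ a ≤ r := by
  refine ⟨fun h μ => (μ.mono h).trans_eq (μ.map_smul_unit r), fun h => ?_⟩
  obtain ⟨μ, hμ⟩ := exists_apply_eq_upper a
  exact upper_le_iff.1 (hμ ▸ h μ)

lemma orderUnitNorm_le_iff_forall {a : A} {r : ℝ} :
    orderUnitNorm a ≤ r ↔ ∀ μ : StateSpace A, |μ a| ≤ r := by
  rw [orderUnitNorm_le_iff, neg_smul_unit_le_iff, le_smul_unit_iff, le_smul_unit_iff,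
    ← forall_and]
  refine forall_congr' fun μ => ?_
  rw [map_neg, abs_le', and_comm]

lemma abs_apply_le (μ : StateSpace A) (a : A) : |μ a| ≤ orderUnitNorm a :=
  orderUnitNorm_le_iff_forall.1 le_rfl μ

lemma eq_smul_unit_of_forall {a : A} {t : ℝ} (h : ∀ μ : StateSpace A, μ a = t) :
    a = t • unit := by
  refine (le_smul_unit_iff.2 fun μ => (h μ).le).antisymm ?_
  have : -a ≤ (-t) • unit := le_smul_unit_iff.2 fun μ => by rw [map_neg, h μ]
  rwa [neg_smul, neg_le_neg_iff] at this

/-- The state `t μ + (1 - t) ν`. -/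
def segment (μ ν : StateSpace A) (t : ℝ) (h0 : 0 ≤ t) (h1 : t ≤ 1) : StateSpace A :=
  ofPositive (t • μ.1 + (1 - t) • ν.1) (by
    simp only [LinearMap.add_apply, LinearMap.smul_apply, map_unit, smul_eq_mul]; ring)
    fun a ha => add_nonneg (mul_nonneg h0 (μ.map_nonneg ha))
      (mul_nonneg (sub_nonneg.2 h1) (ν.map_nonneg ha))

lemma segment_apply (μ ν : StateSpace A) {t : ℝ} (h0 : 0 ≤ t) (h1 : t ≤ 1) (a : A) :
    segment μ ν t h0 h1 a = t * μ a + (1 - t) * ν a := rfl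

/-- The pullback of a state along a positive unital map. -/
def comap {B : Type*} [AddCommGroup B] [PartialOrder B] [Module ℝ B] [OrderUnitSpace B]
    (π : A →ₗ[ℝ] B) (h1 : π unit = unit) (h0 : ∀ a, 0 ≤ a → 0 ≤ π a) (ν : StateSpace B) :
    StateSpace A :=
  ofPositive (ν.1.comp π) (by rw [LinearMap.comp_apply, h1, map_unit]) fun a ha =>
    ν.map_nonneg (h0 a ha)

lemma comap_apply {B : Type*} [AddCommGroup B] [PartialOrder B] [Module ℝ B] [OrderUnitSpace B]
    (π : A →ₗ[ℝ] B) (h1 : π unit = unit) (h0 : ∀ a, 0 ≤ a → 0 ≤ π a) (ν : StateSpace B) (a : A) :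
    comap π h1 h0 ν a = ν (π a) := rfl

/-- The state space is weak-* compact. -/
lemma compactSpace : @CompactSpace (StateSpace A) (weakStarTopology A) := by
  let := weakStarTopology A
  have hind : Topology.IsInducing (fun (μ : StateSpace A) (a : A) => μ a) := ⟨rfl⟩
  rw [← isCompact_univ_iff, hind.isCompact_iff, Set.image_univ]
  -- The interval bounds encode both normalization and positivity, so states are exactly the linear
  -- points of a product of compact intervals; linearity is a closed condition.
  have hrange : Set.range (fun (μ : StateSpace A) (a : A) => μ a) =
      (Set.univ.pi fun a : A => Set.Icc (-upper (-a)) (upper a)) ∩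
        ({f | ∀ a b, f (a + b) = f a + f b} ∩ {f | ∀ (c : ℝ) a, f (c • a) = c * f a}) := by
    ext f
    constructor
    · rintro ⟨μ, rfl⟩
      refine ⟨fun a _ => ⟨?_, ?_⟩, fun a b => map_add _ _ _, fun c a => map_smul _ _ _⟩
      · have := le_smul_unit_iff.1 (le_upper_smul_unit (-a)) μ
        rw [map_neg] at this
        linarith
      · exact le_smul_unit_iff.1 (le_upper_smul_unit a) μ
    · rintro ⟨h, hadd, hsmul⟩
      refine ⟨ofPositive ⟨⟨f, hadd⟩, hsmul⟩ ?_ fun a ha => ?_, rfl⟩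
      · have hunit : upper (unit : A) = 1 := by simpa using upper_smul_unit (A := A) 1
        have hneg : upper (-unit : A) = -1 := by simpa using upper_smul_unit (A := A) (-1)
        have : f unit ∈ Set.Icc (-upper (-unit : A)) (upper (unit : A)) := h unit trivial
        rw [hunit, hneg, neg_neg] at this
        exact this.2.antisymm this.1
      · have h4 : upper (-a) ≤ 0 := upper_le_iff.2 (by simpa using ha)
        have := (h a trivial).1
        change 0 ≤ f a
        linarith
  rw [hrange]
  refine (isCompact_univ_pi fun a => isCompact_Icc).inter_right (IsClosed.inter ?_ ?_)
  · simp only [Set.ofPred_forall]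
    exact isClosed_iInter fun a => isClosed_iInter fun b =>
      isClosed_eq (by fun_prop) (by fun_prop)
  · simp only [Set.ofPred_forall]
    exact isClosed_iInter fun a => isClosed_iInter fun b =>
      isClosed_eq (by fun_prop) (by fun_prop)

end StateSpace

/-- The order-unit norm as a seminorm. -/
def orderUnitSeminorm (A : Type*) [AddCommGroup A] [PartialOrder A] [Module ℝ A]
    [OrderUnitSpace A] : Seminorm ℝ A :=
  Seminorm.ofSMulLE orderUnitNorm
    (by
      refine le_antisymm (StateSpace.orderUnitNorm_le_iff_forall.2 fun μ => by simp) ?_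
      exact (abs_nonneg _).trans (StateSpace.abs_apply_le (Classical.arbitrary (StateSpace A)) 0))
    (fun a b => StateSpace.orderUnitNorm_le_iff_forall.2 fun μ => by
      rw [map_add]
      exact (abs_add_le _ _).trans (add_le_add (μ.abs_apply_le a) (μ.abs_apply_le b)))
    (fun c a => StateSpace.orderUnitNorm_le_iff_forall.2 fun μ => by
      rw [map_smul, smul_eq_mul, abs_mul, Real.norm_eq_abs]
      exact mul_le_mul_of_nonneg_left (μ.abs_apply_le a) (abs_nonneg c))

lemma orderUnitSeminorm_apply {A : Type*} [AddCommGroup A] [PartialOrder A] [Module ℝ A]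
    [OrderUnitSpace A] (a : A) : orderUnitSeminorm A a = orderUnitNorm a := rfl

open OrderUnitSpace

/-- A bounded interval can be cut into finitely many cells of length at most `δ`. -/
lemma exists_interval_cells (R : ℝ) {δ : ℝ} (hδ : 0 < δ) :
    ∃ (n : ℕ) (φ : ℝ → Fin (n + 1)), ∀ x y, |x| ≤ R → |y| ≤ R → φ x = φ y → |x - y| ≤ δ := by
  -- `Fin.ofNat` wraps around, but not for points of `[-R, R]`.
  refine ⟨⌊(R + R) / δ⌋₊, fun x => Fin.ofNat _ ⌊(x + R) / δ⌋₊, fun x y hx hy h => ?_⟩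
  have key : ∀ z : ℝ, |z| ≤ R → ⌊(z + R) / δ⌋₊ < ⌊(R + R) / δ⌋₊ + 1 := fun z hz => by
    have := (abs_le.1 hz).2
    exact Nat.lt_succ_of_le (Nat.floor_le_floor (by gcongr))
  have h' : ⌊(x + R) / δ⌋₊ = ⌊(y + R) / δ⌋₊ := by
    have := congrArg Fin.val h
    simpa [Fin.ofNat, Nat.mod_eq_of_lt (key x hx), Nat.mod_eq_of_lt (key y hy)] using this
  have hx0 : 0 ≤ (x + R) / δ := div_nonneg (by linarith [(abs_le.1 hx).1]) hδ.le
  have hy0 : 0 ≤ (y + R) / δ := div_nonneg (by linarith [(abs_le.1 hy).1]) hδ.le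
  have h1 := Nat.floor_le hx0
  have h2 := Nat.lt_floor_add_one ((x + R) / δ)
  have h3 := Nat.floor_le hy0
  have h4 := Nat.lt_floor_add_one ((y + R) / δ)
  rw [h'] at h1 h2
  have h5 : (x - y) / δ = (x + R) / δ - (y + R) / δ := by ring
  have h6 : (x - y) / δ ≤ 1 := by linarith
  have h7 : -1 ≤ (x - y) / δ := by linarith
  rw [div_le_one hδ] at h6
  rw [le_div_iff₀ hδ] at h7
  exact abs_le.2 ⟨by linarith, h6⟩

/-! ### A total boundedness criterion for Lip-norms. -/

section LipCriterion

variable {A : Type*} [AddCommGroup A] [PartialOrder A] [Module ℝ A] [OrderUnitSpace A]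
  {L : Seminorm ℝ A}

lemma rho_le_iff_of_le_one {μ ν : StateSpace A} {c : ℝ} (hc : 0 ≤ c) :
    rho L μ ν ≤ ENNReal.ofReal c ↔ ∀ a, L a ≤ 1 → |μ a - ν a| ≤ c := by
  simp only [rho, iSup_le_iff, ENNReal.ofReal_le_ofReal_iff hc]

lemma rho_le_iff {μ ν : StateSpace A} {c : ℝ} (hc : 0 ≤ c) :
    rho L μ ν ≤ ENNReal.ofReal c ↔ ∀ a, |μ a - ν a| ≤ c * L a := by
  rw [rho_le_iff_of_le_one hc]
  refine ⟨fun h a => ?_, fun h a ha => (h a).trans (mul_le_of_le_one_right hc ha)⟩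
  refine le_of_forall_pos_le_add fun δ hδ => ?_
  -- `L a` may vanish, so the rescaling uses a slightly larger positive number.
  have hs : 0 < L a + δ / (c + 1) := by have := apply_nonneg L a; positivity
  have h1 := h ((L a + δ / (c + 1))⁻¹ • a) (by
    rw [map_smul_eq_mul, Real.norm_of_nonneg (inv_nonneg.2 hs.le), inv_mul_le_iff₀ hs, mul_one]
    have : 0 < δ / (c + 1) := by positivity
    linarith)
  rw [map_smul, map_smul, smul_eq_mul, smul_eq_mul, ← mul_sub, abs_mul, abs_inv, abs_of_pos hs,
    inv_mul_le_iff₀ hs] at h1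
  refine h1.trans ?_
  have h2 : δ / (c + 1) * c ≤ δ := by
    rw [div_mul_eq_mul_div, div_le_iff₀ (by positivity)]
    nlinarith
  linarith

/-- Up to arbitrarily small oscillation on the state space, the set `{L ≤ 1}` consists of finitely
many elements. -/
def OscTotallyBounded (L : Seminorm ℝ A) : Prop :=
  ∀ ε : ℝ, 0 < ε → ∃ (ι : Type) (_ : Finite ι) (φ : A → ι), ∀ a b, L a ≤ 1 → L b ≤ 1 →
    φ a = φ b → ∀ μ ν : StateSpace A, |μ (a - b) - ν (a - b)| ≤ ε

lemma OscTotallyBounded.exists_reps (h : OscTotallyBounded L) {ε : ℝ} (hε : 0 < ε) :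
    ∃ F : Finset A, ∀ a, L a ≤ 1 → ∃ f ∈ F, ∀ μ ν : StateSpace A,
      |μ (a - f) - ν (a - f)| ≤ ε := by
  classical
  obtain ⟨ι, _, φ, hφ⟩ := h ε hε
  have := Fintype.ofFinite ι
  have : ∀ i : ι, ∃ f : A, ∀ a, L a ≤ 1 → φ a = i → ∀ μ ν : StateSpace A,
      |μ (a - f) - ν (a - f)| ≤ ε := by
    intro i
    by_cases hi : ∃ f, L f ≤ 1 ∧ φ f = i
    · obtain ⟨f, hf, rfl⟩ := hi
      exact ⟨f, fun a ha haf => hφ a f ha hf haf⟩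
    · exact ⟨0, fun a ha hai => (hi ⟨a, ha, hai⟩).elim⟩
  choose f hf using this
  exact ⟨Finset.univ.image f, fun a ha =>
    ⟨f (φ a), Finset.mem_image_of_mem f (Finset.mem_univ _), hf _ a ha rfl⟩⟩

/-- Each element of the unit ball has oscillation within `1` of that of one of finitely many
representatives, and each representative oscillates by at most twice its norm. -/
lemma OscTotallyBounded.exists_bound (h : OscTotallyBounded L) :
    ∃ C : ℝ, 0 ≤ C ∧ ∀ (a : A) (μ ν : StateSpace A), |μ a - ν a| ≤ C * L a := by
  obtain ⟨F, hF⟩ := h.exists_reps one_pos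
  refine ⟨1 + 2 * ∑ f ∈ F, orderUnitSeminorm A f, ?_, fun a μ ν => ?_⟩
  · have := Finset.sum_nonneg fun f (_ : f ∈ F) => apply_nonneg (orderUnitSeminorm A) f
    positivity
  have hC : 0 ≤ 1 + 2 * ∑ f ∈ F, orderUnitSeminorm A f := by
    have := Finset.sum_nonneg fun f (_ : f ∈ F) => apply_nonneg (orderUnitSeminorm A) f
    positivity
  refine (rho_le_iff hC).1 ((rho_le_iff_of_le_one hC).2 fun a ha => ?_) a
  obtain ⟨f, hf, hfa⟩ := hF a ha
  have h1 := hfa μ ν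
  have h2 := μ.abs_apply_le f
  have h3 := ν.abs_apply_le f
  have h4 := Finset.single_le_sum (fun f (_ : f ∈ F) => apply_nonneg (orderUnitSeminorm A) f) hf
  rw [orderUnitSeminorm_apply] at h4
  rw [map_sub, map_sub] at h1
  rw [abs_le] at *
  constructor <;> linarith

/-- Criterion for Lip-norms. -/
lemma OscTotallyBounded.isLipNorm (h : OscTotallyBounded L)
    (h0 : L unit = 0) : IsLipNorm L := by
  refine ⟨fun a => ⟨fun ha => ?_, ?_⟩, ?_⟩
  · obtain ⟨C, hC, hCL⟩ := h.exists_bound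
    let μ₀ : StateSpace A := Classical.arbitrary _
    refine ⟨μ₀ a, StateSpace.eq_smul_unit_of_forall fun μ => ?_⟩
    have := hCL a μ μ₀
    rw [ha, mul_zero] at this
    exact sub_eq_zero.1 (abs_nonpos_iff.1 this)
  · rintro ⟨t, rfl⟩
    rw [map_smul_eq_mul, h0, mul_zero]
  refine le_antisymm ?_ ?_
  -- The `ρ_L`-topology is finer: every evaluation is Lipschitz for `ρ_L`.
  · rw [weakStarTopology, ← continuous_iff_le_induced]
    let := rhoMetric L
    refine continuous_pi fun a => ?_
    rw [Metric.continuous_iff']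
    intro μ ε hε
    have hpos : 0 < ε / (L a + 1) := by have := apply_nonneg L a; positivity
    filter_upwards [Metric.eball_mem_nhds μ (ENNReal.ofReal_pos.2 hpos)] with ν hν
    have h1 : rho L ν μ ≤ ENNReal.ofReal (ε / (L a + 1)) := le_of_lt hν
    have h2 := (rho_le_iff hpos.le).1 h1 a
    rw [Real.dist_eq]
    refine h2.trans_lt ?_
    have := apply_nonneg L a
    rw [div_mul_eq_mul_div, div_lt_iff₀ (by positivity)]
    nlinarith
  -- The weak-* topology is finer: controlling a state on the finitely many representatives controls
  -- it on the whole unit ball.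
  · refine le_of_nhds_le_nhds fun μ => ?_
    intro s hs
    obtain ⟨ε, hε, hεs⟩ := (@EMetric.mem_nhds_iff _ (rhoMetric L) _ _).1 hs
    obtain ⟨δ, hδ, hδε⟩ : ∃ δ : ℝ, 0 < δ ∧ ENNReal.ofReal (2 * δ) < ε := by
      rcases eq_or_ne ε ∞ with rfl | hε'
      · exact ⟨1, one_pos, ENNReal.ofReal_lt_top⟩
      · refine ⟨ε.toReal / 4, div_pos (ENNReal.toReal_pos hε.ne' hε') four_pos, ?_⟩
        rw [ENNReal.ofReal_lt_iff_lt_toReal _ hε'] <;>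
        linarith [ENNReal.toReal_pos hε.ne' hε']
    obtain ⟨F, hF⟩ := h.exists_reps hδ
    let := weakStarTopology A
    have hcont : ∀ f : A, Continuous fun ν : StateSpace A => ν f := fun f =>
      (continuous_apply f).comp continuous_induced_dom
    have hmem : ∀ᶠ ν in nhds μ, ∀ f ∈ F, |ν f - μ f| < δ := by
      refine (Filter.eventually_all_finset F).2 fun f _ => ?_
      have := (hcont f).tendsto μ
      exact (Metric.tendsto_nhds.1 this δ hδ).mono fun ν hν => by rwa [Real.dist_eq] at hν
    refine Filter.mem_of_superset hmem fun ν hν => hεs ?_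
    refine lt_of_le_of_lt ((rho_le_iff_of_le_one (by positivity)).2 fun a ha => ?_) hδε
    obtain ⟨f, hf, hfa⟩ := hF a ha
    have h1 := hfa ν μ
    have h2 := (hν f hf).le
    rw [map_sub, map_sub] at h1
    rw [abs_le] at *
    constructor <;> linarith

lemma IsLipNorm.compactSpace (hL : IsLipNorm L) :
    @CompactSpace (StateSpace A) (rhoMetric L).toUniformSpace.toTopologicalSpace := by
  rw [hL.topology_eq]
  exact StateSpace.compactSpace

lemma IsLipNorm.exists_finite_cover (hL : IsLipNorm L) {ε : ℝ} (hε : 0 < ε) :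
    ∃ (N : ℕ) (f : Fin N → StateSpace A), ∀ μ, ∃ i, rho L μ (f i) < ENNReal.ofReal ε := by
  let := rhoMetric L
  have := hL.compactSpace
  obtain ⟨t, -, ht, hcov⟩ := EMetric.totallyBounded_iff'.1
    (isCompact_univ (X := StateSpace A)).totallyBounded _ (ENNReal.ofReal_pos.2 hε)
  refine ⟨ht.toFinset.card, fun i => (ht.toFinset.equivFin.symm i).1, fun μ => ?_⟩
  obtain ⟨ν, hν, hμν⟩ := Set.mem_iUnion₂.1 (hcov (Set.mem_univ μ))
  refine ⟨ht.toFinset.equivFin ⟨ν, ht.mem_toFinset.2 hν⟩, ?_⟩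
  beta_reduce
  rw [Equiv.symm_apply_apply]
  exact hμν

/-- The points `ν + (μ - ν) / (n + 1)` converge weak-* to `ν`, so one of them lies within
`ρ_L`-distance `1`; scaling by `n + 1` bounds the distance from `μ` to `ν`. -/
lemma IsLipNorm.rho_lt_top (hL : IsLipNorm L) (μ ν : StateSpace A) :
    ∃ c : ℝ, 0 ≤ c ∧ ∀ a, |μ a - ν a| ≤ c * L a := by
  have h0 : ∀ n : ℕ, (0 : ℝ) ≤ 1 / ((n : ℝ) + 1) := fun n => by positivity
  have h1 : ∀ n : ℕ, 1 / ((n : ℝ) + 1) ≤ 1 := fun n => by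
    rw [div_le_one (by positivity)]; linarith [n.cast_nonneg (α := ℝ)]
  let κ : ℕ → StateSpace A := fun n => StateSpace.segment μ ν _ (h0 n) (h1 n)
  have hlim : Filter.Tendsto κ Filter.atTop (@nhds _ (weakStarTopology A) ν) := by
    rw [nhds_induced, Filter.tendsto_comap_iff, tendsto_pi_nhds]
    intro a
    have h2 : Filter.Tendsto (fun n : ℕ => 1 / ((n : ℝ) + 1) * μ a + (1 - 1 / ((n : ℝ) + 1)) * ν a)
        Filter.atTop (nhds (0 * μ a + (1 - 0) * ν a)) :=
      (tendsto_one_div_add_atTop_nhds_zero_nat.mul_const _).add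
        ((tendsto_const_nhds.sub tendsto_one_div_add_atTop_nhds_zero_nat).mul_const _)
    simpa [κ, Function.comp_def, StateSpace.segment_apply] using h2
  rw [← hL.topology_eq] at hlim
  have hball := hlim (@Metric.eball_mem_nhds _ (rhoMetric L) ν _ one_pos)
  obtain ⟨n, hn⟩ := (Filter.Eventually.exists (f := Filter.atTop) hball)
  have hn' : rho L (κ n) ν ≤ ENNReal.ofReal 1 := by
    rw [ENNReal.ofReal_one]; exact le_of_lt hn
  refine ⟨(n : ℝ) + 1, by positivity, fun a => ?_⟩
  have h3 := (rho_le_iff zero_le_one).1 hn' a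
  have hpos : (0 : ℝ) < (n : ℝ) + 1 := by positivity
  have h4 : κ n a - ν a = 1 / ((n : ℝ) + 1) * (μ a - ν a) := by
    simp only [κ, StateSpace.segment_apply]; ring
  rw [h4, abs_mul, abs_of_pos (by positivity), one_div, inv_mul_le_iff₀ hpos, one_mul] at h3
  exact h3

/-- Weak-* compactness gives a finite `ρ_L`-net of states. An element is classified by its rounded
values on the net relative to a base state; these are bounded because distances are finite. Three
errors of `ε / 6` for each of two states add up to `ε`. -/
lemma IsLipNorm.oscTotallyBounded (hL : IsLipNorm L) : OscTotallyBounded L := by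
  intro ε hε
  obtain ⟨N, f, hf⟩ := hL.exists_finite_cover (show 0 < ε / 6 by positivity)
  let μ₀ : StateSpace A := Classical.arbitrary _
  choose c hc0 hc using fun i => hL.rho_lt_top (f i) μ₀
  obtain ⟨n, φ, hφ⟩ := exists_interval_cells (∑ i, c i) (show 0 < ε / 6 by positivity)
  refine ⟨Fin N → Fin (n + 1), inferInstance, fun a i => φ (f i a - μ₀ a), ?_⟩
  intro a b ha hb hab μ ν
  have hbound : ∀ x, L x ≤ 1 → ∀ i, |f i x - μ₀ x| ≤ ∑ i, c i := fun x hx i =>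
    (hc i x).trans <| (mul_le_of_le_one_right (hc0 i) hx).trans <|
      Finset.single_le_sum (fun i _ => hc0 i) (Finset.mem_univ i)
  have key : ∀ κ : StateSpace A, |κ (a - b) - μ₀ (a - b)| ≤ ε / 2 := by
    intro κ
    obtain ⟨i, hi⟩ := hf κ
    have h1 := hφ _ _ (hbound a ha i) (hbound b hb i) (congrFun hab i)
    have h2 := (rho_le_iff_of_le_one (by positivity)).1 hi.le a ha
    have h3 := (rho_le_iff_of_le_one (by positivity)).1 hi.le b hb
    rw [map_sub, map_sub]
    rw [abs_le] at *
    constructor <;> linarith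
  have h1 := key μ
  have h2 := key ν
  rw [abs_le] at *
  constructor <;> linarith

/-- Gluing: if `Z` embeds in `P × Q` as an order-unit space and `L` dominates Lip-norms on `P` and
`Q` as well as the difference of some state of `P` and some state of `Q`, then `L` satisfies
the total boundedness criterion. -/
lemma OscTotallyBounded.glue {P Q : Type*}
    [AddCommGroup P] [PartialOrder P] [Module ℝ P] [OrderUnitSpace P]
    [AddCommGroup Q] [PartialOrder Q] [Module ℝ Q] [OrderUnitSpace Q]
    {LP : Seminorm ℝ P} {LQ : Seminorm ℝ Q} (hP : OscTotallyBounded LP)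
    (hQ : OscTotallyBounded LQ) (p : A →ₗ[ℝ] P) (q : A →ₗ[ℝ] Q)
    (hp1 : p unit = unit) (hq1 : q unit = unit) (hle : ∀ z, p z ≤ 0 → q z ≤ 0 → z ≤ 0)
    (hpL : ∀ z, LP (p z) ≤ L z) (hqL : ∀ z, LQ (q z) ≤ L z)
    (σ : StateSpace P) (τ : StateSpace Q) (C : ℝ) (hC : ∀ z, |σ (p z) - τ (q z)| ≤ C * L z) :
    OscTotallyBounded L := by
  intro ε hε
  obtain ⟨ι, _, φ, hφ⟩ := hP (ε / 6) (by positivity)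
  obtain ⟨κ, _, ψ, hψ⟩ := hQ (ε / 6) (by positivity)
  obtain ⟨n, χ, hχ⟩ := exists_interval_cells |C| (show 0 < ε / 6 by positivity)
  refine ⟨ι × κ × Fin (n + 1), inferInstance,
    fun z => (φ (p z), ψ (q z), χ (σ (p z) - τ (q z))), ?_⟩
  intro x y hx hy hxy μ ν
  simp only [Prod.mk.injEq] at hxy
  obtain ⟨h1, h2, h3⟩ := hxy
  have hbound : ∀ z, L z ≤ 1 → |σ (p z) - τ (q z)| ≤ |C| := fun z hz =>
    (hC z).trans <| (mul_le_mul_of_nonneg_right (le_abs_self C) (apply_nonneg L z)).trans <|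
      mul_le_of_le_one_right (abs_nonneg C) hz
  have h1' := hφ _ _ ((hpL x).trans hx) ((hpL y).trans hy) h1
  have h2' := hψ _ _ ((hqL x).trans hx) ((hqL y).trans hy) h2
  have h3' := hχ _ _ (hbound x hx) (hbound y hy) h3
  rw [← map_sub p] at h1'
  rw [← map_sub q] at h2'
  -- Small oscillation on `P` and on `Q` separately does not compare the two levels; the third index
  -- does.
  have h4 : |σ (p (x - y)) - τ (q (x - y))| ≤ ε / 6 := by
    rw [map_sub p, map_sub q, map_sub, map_sub]
    rwa [sub_sub_sub_comm]
  generalize x - y = z at *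
  set s := σ (p z)
  have hupper : z ≤ (s + ε / 2) • unit := by
    rw [← sub_nonpos]
    refine hle _ ?_ ?_
    · rw [map_sub, map_smul, hp1, sub_nonpos, StateSpace.le_smul_unit_iff]
      intro μ
      have := (abs_le.1 (h1' μ σ)).2
      linarith
    · rw [map_sub, map_smul, hq1, sub_nonpos, StateSpace.le_smul_unit_iff]
      intro μ
      have := (abs_le.1 (h2' μ τ)).2
      have := (abs_le.1 h4).1
      linarith
  have hlower : -z ≤ (-s + ε / 2) • unit := by
    rw [← sub_nonpos]
    refine hle _ ?_ ?_
    · rw [map_sub, map_smul, hp1, sub_nonpos, StateSpace.le_smul_unit_iff]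
      intro μ
      have := (abs_le.1 (h1' μ σ)).1
      rw [map_neg, map_neg]
      linarith
    · rw [map_sub, map_smul, hq1, sub_nonpos, StateSpace.le_smul_unit_iff]
      intro μ
      have := (abs_le.1 (h2' μ τ)).1
      have := (abs_le.1 h4).2
      rw [map_neg, map_neg]
      linarith
  rw [StateSpace.le_smul_unit_iff] at hupper hlower
  have e1 := hupper μ
  have e2 := hupper ν
  have e3 := hlower μ
  have e4 := hlower ν
  rw [map_neg] at e3 e4
  exact abs_le.2 ⟨by linarith, by linarith⟩

end LipCriterion

lemma IsLipNorm.map_unit_eq_zero {A : Type*} [AddCommGroup A] [PartialOrder A] [Module ℝ A]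
    [OrderUnitSpace A] {L : Seminorm ℝ A} (hL : IsLipNorm L) : L unit = 0 :=
  (hL.eq_zero_iff _).2 ⟨1, (one_smul _ _).symm⟩

/-! ### Seminorms induced on quotients. -/

section Quotient

variable {A B : Type*} [AddCommGroup A] [Module ℝ A] [AddCommGroup B] [Module ℝ B]
  {L : Seminorm ℝ A} {π : A →ₗ[ℝ] B} {LB : Seminorm ℝ B}

lemma Induces.apply_le (h : Induces L π LB) (a : A) : LB (π a) ≤ L a :=
  (h (π a)).1 ⟨a, rfl, rfl⟩

lemma Induces.exists_lt (h : Induces L π LB) {b : B} {r : ℝ} (hr : LB b < r) :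
    ∃ a, π a = b ∧ L a < r := by
  by_contra! hcon
  refine absurd ((h b).2 ?_) (not_le_of_gt hr)
  rintro t ⟨a, ha, rfl⟩
  exact hcon a ha

lemma Induces.le_of_forall (h : Induces L π LB) {b : B} {r c : ℝ} (hc : 0 ≤ c)
    (hr : ∀ a, π a = b → r ≤ c * L a) : r ≤ c * LB b := by
  refine le_of_forall_pos_le_add fun δ hδ => ?_
  have hpos : 0 < δ / (c + 1) := by positivity
  obtain ⟨a, ha, hlt⟩ := h.exists_lt (lt_add_of_pos_right (LB b) hpos)
  have h2 : δ / (c + 1) * c ≤ δ := by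
    rw [div_mul_eq_mul_div, div_le_iff₀ (by positivity)]
    nlinarith
  nlinarith [hr a ha, mul_le_mul_of_nonneg_left hlt.le hc]

lemma Induces.of_exists (h1 : ∀ a, LB (π a) ≤ L a)
    (h2 : ∀ b, ∀ δ : ℝ, 0 < δ → ∃ a, π a = b ∧ L a ≤ LB b + δ) : Induces L π LB := by
  refine fun b => ⟨?_, fun t ht => ?_⟩
  · rintro t ⟨a, rfl, rfl⟩
    exact h1 a
  · refine le_of_forall_pos_le_add fun δ hδ => ?_
    obtain ⟨a, ha, hle⟩ := h2 b δ hδ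
    exact (ht ⟨a, ha, rfl⟩).trans hle

/-- Any seminorm induces a seminorm along a surjection. -/
lemma exists_induces (L : Seminorm ℝ A) (hπ : Function.Surjective π) :
    ∃ LB : Seminorm ℝ B, Induces L π LB := by
  let S : B → Set ℝ := fun b => {t : ℝ | ∃ a : A, π a = b ∧ t = L a}
  have hne : ∀ b, (S b).Nonempty := fun b => by
    obtain ⟨a, ha⟩ := hπ b
    exact ⟨L a, a, ha, rfl⟩
  have h0 : ∀ b, 0 ∈ lowerBounds (S b) := by
    rintro b t ⟨a, -, rfl⟩
    exact apply_nonneg L a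
  have hbdd : ∀ b, BddBelow (S b) := fun b => ⟨0, h0 b⟩
  have hmem : ∀ a, sInf (S (π a)) ≤ L a := fun a => csInf_le (hbdd _) ⟨a, rfl, rfl⟩
  have hlt : ∀ b, ∀ δ : ℝ, 0 < δ → ∃ a, π a = b ∧ L a < sInf (S b) + δ := fun b δ hδ => by
    obtain ⟨t, ⟨a, ha, rfl⟩, ht⟩ := exists_lt_of_csInf_lt (hne b) (lt_add_of_pos_right _ hδ)
    exact ⟨a, ha, ht⟩
  refine ⟨Seminorm.ofSMulLE (fun b => sInf (S b)) ?_ ?_ ?_, fun b => isGLB_csInf (hne b) (hbdd b)⟩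
  · refine le_antisymm ?_ (le_csInf (hne 0) (h0 0))
    simpa using hmem 0
  · intro b b'
    refine le_of_forall_pos_le_add fun δ hδ => ?_
    obtain ⟨a, rfl, ha⟩ := hlt b (δ / 2) (by positivity)
    obtain ⟨a', rfl, ha'⟩ := hlt b' (δ / 2) (by positivity)
    have h1 := hmem (a + a')
    rw [map_add] at h1
    have h2 := map_add_le_add L a a'
    linarith
  · intro c b
    refine le_of_forall_pos_le_add fun δ hδ => ?_
    have hpos : 0 < δ / (‖c‖ + 1) := by positivity
    obtain ⟨a, rfl, ha⟩ := hlt b _ hpos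
    have h1 := hmem (c • a)
    rw [map_smul, map_smul_eq_mul] at h1
    have h2 : δ / (‖c‖ + 1) * ‖c‖ ≤ δ := by
      rw [div_mul_eq_mul_div, div_le_iff₀ (by positivity)]
      nlinarith [norm_nonneg c]
    have h3 := mul_le_mul_of_nonneg_left ha.le (norm_nonneg c)
    nlinarith

variable [PartialOrder A] [OrderUnitSpace A] [PartialOrder B] [OrderUnitSpace B]

lemma Induces.oscTotallyBounded (h : Induces L π LB) (h1 : π unit = unit)
    (h0 : ∀ a, 0 ≤ a → 0 ≤ π a) (hL : OscTotallyBounded L) : OscTotallyBounded LB := by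
  intro ε hε
  obtain ⟨ι, hι, φ, hφ⟩ := hL (ε / 2) (by positivity)
  choose s hs hsL using fun b => h.exists_lt (lt_add_one (LB b))
  -- The infimum need not be attained: lifts only have seminorm below `2`, so they are halved and
  -- classified at scale `ε / 2`.
  refine ⟨ι, hι, fun b => φ ((2 : ℝ)⁻¹ • s b), fun a b ha hb hab μ ν => ?_⟩
  have hhalf : ∀ x, LB x ≤ 1 → L ((2 : ℝ)⁻¹ • s x) ≤ 1 := fun x hx => by
    rw [map_smul_eq_mul, Real.norm_of_nonneg (by norm_num)]
    linarith [hsL x]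
  have key := hφ _ _ (hhalf a ha) (hhalf b hb) hab (StateSpace.comap π h1 h0 μ)
    (StateSpace.comap π h1 h0 ν)
  rw [StateSpace.comap_apply, StateSpace.comap_apply, ← smul_sub, map_smul, map_sub, hs, hs,
    map_smul, map_smul, smul_eq_mul, smul_eq_mul, ← mul_sub, abs_mul,
    abs_of_pos (by norm_num : (0 : ℝ) < 2⁻¹)] at key
  linarith

lemma Induces.isLipNorm (h : Induces L π LB) (h1 : π unit = unit)
    (h0 : ∀ a, 0 ≤ a → 0 ≤ π a) (hL : OscTotallyBounded L) (hL1 : L unit = 0) : IsLipNorm LB := by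
  refine (h.oscTotallyBounded h1 h0 hL).isLipNorm ((apply_nonneg LB _).antisymm' ?_)
  rw [← h1, ← hL1]
  exact h.apply_le unit

end Quotient

/-! ### Matching states, the triangle inequality, and bridges. -/

namespace CompactQuantumMetricSpace

variable {X Y Z : CompactQuantumMetricSpace.{u}}

/-- With `exists_lipNorm_of_distq_lt`, this trades Hausdorff distances for real inequalities between
matched states. -/
lemma distq_le_of_states {L : Seminorm ℝ (X.carrier × Y.carrier)} (hL : L ∈ lipNorms X Y) {d : ℝ}
    (hd : 0 ≤ d)
    (hXY : ∀ μ : StateSpace X.carrier, ∃ ν : StateSpace Y.carrier, ∀ a b,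
      |μ a - ν b| ≤ d * L (a, b))
    (hYX : ∀ ν : StateSpace Y.carrier, ∃ μ : StateSpace X.carrier, ∀ a b,
      |μ a - ν b| ≤ d * L (a, b)) :
    distq X Y ≤ ENNReal.ofReal d := by
  refine iInf₂_le_of_le L hL ?_
  refine @Metric.hausdorffEDist_le_of_mem_edist _ (rhoMetric L) _ _ _ ?_ ?_
  · rintro σ ⟨μ, hμ⟩
    obtain ⟨ν, hν⟩ := hXY μ
    refine ⟨StateSpace.comap (LinearMap.snd ℝ X.carrier Y.carrier) rfl (fun a ha => ha.2) ν,
      ⟨ν, fun _ => rfl⟩, (rho_le_iff hd).2 fun z => ?_⟩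
    rw [hμ]
    exact hν z.1 z.2
  · rintro σ ⟨ν, hν⟩
    obtain ⟨μ, hμ⟩ := hYX ν
    refine ⟨StateSpace.comap (LinearMap.fst ℝ X.carrier Y.carrier) rfl (fun a ha => ha.1) μ,
      ⟨μ, fun _ => rfl⟩, (rho_le_iff hd).2 fun z => ?_⟩
    rw [hν, abs_sub_comm]
    exact hμ z.1 z.2

lemma exists_lipNorm_of_distq_lt {ε : ℝ} (h : distq X Y < ENNReal.ofReal ε) :
    ∃ L ∈ lipNorms X Y, ∃ d, 0 ≤ d ∧ d < ε ∧
      (∀ μ : StateSpace X.carrier, ∃ ν : StateSpace Y.carrier, ∀ a b,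
        |μ a - ν b| ≤ d * L (a, b)) ∧
      (∀ ν : StateSpace Y.carrier, ∃ μ : StateSpace X.carrier, ∀ a b,
        |μ a - ν b| ≤ d * L (a, b)) := by
  obtain ⟨L, hlt⟩ := iInf_lt_iff.1 h
  obtain ⟨hL, hlt⟩ := iInf_lt_iff.1 hlt
  obtain ⟨r, hr, hrε⟩ := exists_between hlt
  have hrtop : r ≠ ∞ := (hrε.trans_le le_top).ne
  have hrd : r = ENNReal.ofReal r.toReal := (ENNReal.ofReal_toReal hrtop).symm
  refine ⟨L, hL, r.toReal, ENNReal.toReal_nonneg, ?_, fun μ => ?_, fun ν => ?_⟩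
  · exact ENNReal.toReal_lt_of_lt_ofReal hrε
  · obtain ⟨τ, ⟨ν, hν⟩, hlt⟩ := @Metric.exists_edist_lt_of_hausdorffEDist_lt _ (rhoMetric L)
      (StateSpace.comap (LinearMap.fst ℝ X.carrier Y.carrier) rfl (fun a ha => ha.1) μ) _ _ r
      (show _ ∈ stateImage _ from ⟨μ, fun _ => rfl⟩) hr
    refine ⟨ν, fun a b => ?_⟩
    have hle := hlt.le
    rw [hrd] at hle
    have := (rho_le_iff ENNReal.toReal_nonneg).1 hle (a, b)
    rwa [hν] at this
  · rw [@Metric.hausdorffEDist_comm _ (rhoMetric L)] at hr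
    obtain ⟨τ, ⟨μ, hμ⟩, hlt⟩ := @Metric.exists_edist_lt_of_hausdorffEDist_lt _ (rhoMetric L)
      (StateSpace.comap (LinearMap.snd ℝ X.carrier Y.carrier) rfl (fun a ha => ha.2) ν) _ _ r
      (show _ ∈ stateImage _ from ⟨ν, fun _ => rfl⟩) hr
    refine ⟨μ, fun a b => ?_⟩
    have hle := hlt.le
    rw [hrd] at hle
    have := (rho_le_iff ENNReal.toReal_nonneg).1 hle (a, b)
    rw [hμ, abs_sub_comm] at this
    exact this

/-- Take the maximum of the two Lip-norms on the triple sum and pass to its quotient seminorm on the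
outer summands; matched states compose through the middle space. -/
lemma distq_lt_add {d e : ℝ} (h1 : distq X Y < ENNReal.ofReal d)
    (h2 : distq Y Z < ENNReal.ofReal e) : distq X Z < ENNReal.ofReal (d + e) := by
  obtain ⟨L₁, ⟨hL₁, hX₁, hY₁⟩, d', hd'0, hd', hXY, hYX⟩ := exists_lipNorm_of_distq_lt h1
  obtain ⟨L₂, ⟨hL₂, hY₂, hZ₂⟩, e', he'0, he', hYZ, hZY⟩ := exists_lipNorm_of_distq_lt h2
  let q : (X.carrier × Y.carrier) × Z.carrier →ₗ[ℝ] Y.carrier × Z.carrier :=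
    LinearMap.prodMap (LinearMap.snd ℝ X.carrier Y.carrier) LinearMap.id
  let p : (X.carrier × Y.carrier) × Z.carrier →ₗ[ℝ] X.carrier × Z.carrier :=
    LinearMap.prodMap (LinearMap.fst ℝ X.carrier Y.carrier) LinearMap.id
  let M : Seminorm ℝ ((X.carrier × Y.carrier) × Z.carrier) :=
    L₁.comp (LinearMap.fst ℝ _ _) ⊔ L₂.comp q
  have hM₁ : ∀ x y z, L₁ (x, y) ≤ M ((x, y), z) := fun x y z =>
    (le_sup_left : L₁.comp (LinearMap.fst ℝ _ _) ≤ M) ((x, y), z)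
  have hM₂ : ∀ x y z, L₂ (y, z) ≤ M ((x, y), z) := fun x y z =>
    (le_sup_right : L₂.comp q ≤ M) ((x, y), z)
  have hM : ∀ x y z r, L₁ (x, y) ≤ r → L₂ (y, z) ≤ r → M ((x, y), z) ≤ r := fun x y z r h h' =>
    max_le h h'
  let ν₀ : StateSpace Y.carrier := Classical.arbitrary _
  have hMosc : OscTotallyBounded M := hL₁.oscTotallyBounded.glue hL₂.oscTotallyBounded
    (LinearMap.fst ℝ _ _) q rfl rfl (fun z h h' => ⟨h, h'.2⟩) (fun z => hM₁ _ _ _)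
    (fun z => hM₂ _ _ _)
    (StateSpace.comap (LinearMap.snd ℝ X.carrier Y.carrier) rfl (fun a ha => ha.2) ν₀)
    (StateSpace.comap (LinearMap.fst ℝ Y.carrier Z.carrier) rfl (fun a ha => ha.1) ν₀) 0
    -- The gluing constant is `0`, because both states are the same state of the shared summand.
    (fun z => by rw [zero_mul]; exact (abs_nonpos_iff.2 (sub_self (ν₀ z.1.2))))
  have hM0 : M unit = 0 := le_antisymm
    (hM _ _ _ _ hL₁.map_unit_eq_zero.le hL₂.map_unit_eq_zero.le) (apply_nonneg M _)
  obtain ⟨L, hL⟩ := exists_induces (π := p) M fun z => ⟨((z.1, 0), z.2), rfl⟩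
  have hLmem : L ∈ lipNorms X Z := by
    refine ⟨hL.isLipNorm rfl (fun a ha => ⟨ha.1.1, ha.2⟩) hMosc hM0,
      Induces.of_exists (fun a => ?_) fun x δ hδ => ?_,
      Induces.of_exists (fun a => ?_) fun z δ hδ => ?_⟩
    · rw [← one_mul (L a)]
      refine hL.le_of_forall zero_le_one fun w hw => ?_
      rw [one_mul, ← hw]
      exact (hX₁.apply_le w.1).trans (hM₁ _ _ _)
    -- Lift `x` to `(x, y)`; the Lip-norm of `y` obeys the same bound, so `y` lifts in turn to a
    -- pair `(y, z)`.
    · obtain ⟨⟨x, y⟩, rfl, hy⟩ := hX₁.exists_lt (lt_add_of_pos_right _ hδ)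
      obtain ⟨⟨y', z⟩, rfl, hz⟩ := hY₂.exists_lt ((hY₁.apply_le (x, y)).trans_lt hy)
      exact ⟨(x, z), rfl, (hL.apply_le ((x, y'), z)).trans (hM _ _ _ _ hy.le hz.le)⟩
    · rw [← one_mul (L a)]
      refine hL.le_of_forall zero_le_one fun w hw => ?_
      rw [one_mul, ← hw]
      exact (hZ₂.apply_le (q w)).trans (hM₂ _ _ _)
    · obtain ⟨⟨y, z⟩, rfl, hy⟩ := hZ₂.exists_lt (lt_add_of_pos_right _ hδ)
      obtain ⟨⟨x, y'⟩, rfl, hx⟩ := hY₁.exists_lt ((hY₂.apply_le (y, z)).trans_lt hy)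
      exact ⟨(x, z), rfl, (hL.apply_le ((x, y'), z)).trans (hM _ _ _ _ hx.le hy.le)⟩
  have hde : 0 ≤ d' + e' := add_nonneg hd'0 he'0
  have key : ∀ (μ : StateSpace X.carrier) (ν : StateSpace Y.carrier) (κ : StateSpace Z.carrier),
      (∀ a b, |μ a - ν b| ≤ d' * L₁ (a, b)) → (∀ a b, |ν a - κ b| ≤ e' * L₂ (a, b)) →
      ∀ a b, |μ a - κ b| ≤ (d' + e') * L (a, b) := by
    intro μ ν κ h h' a b
    refine hL.le_of_forall hde ?_
    rintro ⟨⟨x, y⟩, z⟩ hxyz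
    obtain ⟨rfl, rfl⟩ : x = a ∧ z = b := Prod.mk.inj hxyz
    calc |μ x - κ z| ≤ |μ x - ν y| + |ν y - κ z| := abs_sub_le _ _ _
      _ ≤ d' * L₁ (x, y) + e' * L₂ (y, z) := add_le_add (h _ _) (h' _ _)
      _ ≤ d' * M ((x, y), z) + e' * M ((x, y), z) := add_le_add
        (mul_le_mul_of_nonneg_left (hM₁ _ _ _) hd'0) (mul_le_mul_of_nonneg_left (hM₂ _ _ _) he'0)
      _ = _ := (add_mul _ _ _).symm
  refine (distq_le_of_states hLmem hde (fun μ => ?_) fun κ => ?_).trans_lt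
    ((ENNReal.ofReal_lt_ofReal_iff (by linarith)).2 (add_lt_add hd' he'))
  · obtain ⟨ν, hν⟩ := hXY μ
    obtain ⟨κ, hκ⟩ := hYZ ν
    exact ⟨κ, key μ ν κ hν hκ⟩
  · obtain ⟨ν, hν⟩ := hZY κ
    obtain ⟨μ, hμ⟩ := hYX ν
    exact ⟨μ, key μ ν κ hμ hν⟩

/-- A unital linear map that almost matches the Lip-norms and the states of two compact quantum
metric spaces bounds their distance. -/
lemma distq_le_of_bridge (T : X.carrier →ₗ[ℝ] Y.carrier) (hT1 : T unit = unit) {γ η : ℝ}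
    (hγ : 0 < γ) (hη : 0 ≤ η)
    (hX : ∀ a, ∃ b, Y.lip b ≤ X.lip a ∧ orderUnitNorm (T a - b) ≤ γ * X.lip a)
    (hY : ∀ b, ∀ δ : ℝ, 0 < δ → ∃ a, X.lip a ≤ Y.lip b + δ ∧
      orderUnitNorm (T a - b) ≤ γ * (Y.lip b + δ))
    (hXY : ∀ μ : StateSpace X.carrier, ∃ ν : StateSpace Y.carrier, ∀ a,
      |μ a - ν (T a)| ≤ η * X.lip a)
    (hYX : ∀ ν : StateSpace Y.carrier, ∃ μ : StateSpace X.carrier, ∀ a,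
      |μ a - ν (T a)| ≤ η * X.lip a) :
    distq X Y ≤ ENNReal.ofReal (η + γ) := by
  -- The bridge term `γ⁻¹ ‖T a - b‖` joins the two Lip-norms in a maximum; it makes `b` and `T a`
  -- nearly equal on the unit ball.
  let t : X.carrier × Y.carrier →ₗ[ℝ] Y.carrier :=
    γ⁻¹ • (T.comp (LinearMap.fst ℝ _ _) - LinearMap.snd ℝ _ _)
  let N : Seminorm ℝ (X.carrier × Y.carrier) := (orderUnitSeminorm Y.carrier).comp t
  have hN : ∀ a b, N (a, b) = γ⁻¹ * orderUnitNorm (T a - b) := fun a b => by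
    change orderUnitSeminorm Y.carrier (γ⁻¹ • (T a - b)) = _
    rw [map_smul_eq_mul, Real.norm_of_nonneg (inv_nonneg.2 hγ.le), orderUnitSeminorm_apply]
  let L : Seminorm ℝ (X.carrier × Y.carrier) :=
    X.lip.comp (LinearMap.fst ℝ _ _) ⊔ Y.lip.comp (LinearMap.snd ℝ _ _) ⊔ N
  have hLX : ∀ z, X.lip z.1 ≤ L z := fun z =>
    (le_sup_left.trans le_sup_left : X.lip.comp (LinearMap.fst ℝ _ _) ≤ L) z
  have hLY : ∀ z, Y.lip z.2 ≤ L z := fun z =>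
    (le_sup_right.trans le_sup_left : Y.lip.comp (LinearMap.snd ℝ _ _) ≤ L) z
  have hLN : ∀ z, orderUnitNorm (T z.1 - z.2) ≤ γ * L z := fun z => by
    have : N (z.1, z.2) ≤ L z := (le_sup_right : N ≤ L) z
    rwa [hN, inv_mul_le_iff₀ hγ] at this
  have hL : ∀ a b r, X.lip a ≤ r → Y.lip b ≤ r → orderUnitNorm (T a - b) ≤ γ * r →
      L (a, b) ≤ r := fun a b r h1 h2 h3 => by
    refine max_le (max_le h1 h2) ?_
    rw [hN, inv_mul_le_iff₀ hγ]
    exact h3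
  have key : ∀ (μ : StateSpace X.carrier) (ν : StateSpace Y.carrier),
      (∀ a, |μ a - ν (T a)| ≤ η * X.lip a) → ∀ a b, |μ a - ν b| ≤ (η + γ) * L (a, b) := by
    intro μ ν h a b
    have h1 := h a
    have h2 := (ν.abs_apply_le (T a - b)).trans (hLN (a, b))
    have h3 := mul_le_mul_of_nonneg_left (hLX (a, b)) hη
    rw [map_sub] at h2
    rw [add_mul]
    calc |μ a - ν b| ≤ |μ a - ν (T a)| + |ν (T a) - ν b| := abs_sub_le _ _ _
      _ ≤ _ := by linarith
  have hosc : OscTotallyBounded L := by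
    let μ₀ : StateSpace X.carrier := Classical.arbitrary _
    obtain ⟨ν₀, hν₀⟩ := hXY μ₀
    exact X.isLipNorm.oscTotallyBounded.glue Y.isLipNorm.oscTotallyBounded
      (LinearMap.fst ℝ _ _) (LinearMap.snd ℝ _ _) rfl rfl (fun z h h' => ⟨h, h'⟩) hLX hLY
      μ₀ ν₀ (η + γ) fun z => key μ₀ ν₀ hν₀ z.1 z.2
  have h0 : orderUnitNorm (0 : Y.carrier) = 0 := map_zero (orderUnitSeminorm Y.carrier)
  have hmem : L ∈ lipNorms X Y := by
    refine ⟨hosc.isLipNorm (le_antisymm (hL _ _ _ X.isLipNorm.map_unit_eq_zero.le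
        Y.isLipNorm.map_unit_eq_zero.le ?_) (apply_nonneg L _)),
      Induces.of_exists hLX fun x δ hδ => ?_, Induces.of_exists hLY fun y δ hδ => ?_⟩
    · rw [hT1, sub_self, h0, mul_zero]
    · obtain ⟨b, hb, hb'⟩ := hX x
      refine ⟨(x, b), rfl, (hL x b _ le_rfl hb hb').trans (by linarith)⟩
    · obtain ⟨a, ha, ha'⟩ := hY y δ hδ
      exact ⟨(a, y), rfl, hL a y _ ha (by linarith) ha'⟩
  refine distq_le_of_states hmem (by positivity) (fun μ => ?_) fun ν => ?_
  · obtain ⟨ν, hν⟩ := hXY μ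
    exact ⟨ν, key μ ν hν⟩
  · obtain ⟨μ, hμ⟩ := hYX ν
    exact ⟨μ, key μ ν hμ⟩

end CompactQuantumMetricSpace

/-- A space of functions on a finite set which contains the constants is an order-unit space. -/
abbrev OrderUnitSpace.ofFunctions {ι : Type*} [Finite ι] [Nonempty ι] (p : Submodule ℝ (ι → ℝ))
    (h : 1 ∈ p) : OrderUnitSpace p where
  add_le_add_left _ _ h c := add_le_add_left (α := ι → ℝ) h c
  smul_le_smul_of_nonneg_left r hr _ _ h := smul_le_smul_of_nonneg_left (β := ι → ℝ) h hr
  unit := ⟨1, h⟩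
  unit_pos := (zero_lt_one : (0 : ι → ℝ) < 1)
  exists_le_smul_unit a := by
    obtain ⟨r, hr⟩ := (Set.finite_range a.1).bddAbove
    exact ⟨r, fun i => by simpa using hr ⟨i, rfl⟩⟩
  archimedean a h i := le_of_forall_pos_le_add fun r hr => by simpa using h r hr i

/-! ### Symmetry, diameter and nets; consequences of total boundedness. -/

namespace CompactQuantumMetricSpace

variable {X Y : CompactQuantumMetricSpace.{u}}

lemma distq_comm_lt {ε : ℝ} (h : distq X Y < ENNReal.ofReal ε) :
    distq Y X < ENNReal.ofReal ε := by
  obtain ⟨L, ⟨hL, hX, hY⟩, d, hd0, hd, hXY, hYX⟩ := exists_lipNorm_of_distq_lt h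
  let M : Seminorm ℝ (Y.carrier × X.carrier) :=
    L.comp (LinearEquiv.prodComm ℝ Y.carrier X.carrier).toLinearMap
  have hM : Induces L (LinearEquiv.prodComm ℝ X.carrier Y.carrier).toLinearMap M :=
    Induces.of_exists (fun a => le_rfl) fun b δ hδ => ⟨b.swap, rfl, by
      change L b.swap ≤ L b.swap + δ
      linarith⟩
  have hmem : M ∈ lipNorms Y X := by
    refine ⟨hM.isLipNorm rfl (fun a ha => ⟨ha.2, ha.1⟩) hL.oscTotallyBounded
        hL.map_unit_eq_zero, ?_, ?_⟩
    · refine Induces.of_exists (fun a => hY.apply_le a.swap) fun b δ hδ => ?_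
      obtain ⟨a, ha, hlt⟩ := hY.exists_lt (lt_add_of_pos_right _ hδ)
      exact ⟨a.swap, ha, hlt.le⟩
    · refine Induces.of_exists (fun a => hX.apply_le a.swap) fun b δ hδ => ?_
      obtain ⟨a, ha, hlt⟩ := hX.exists_lt (lt_add_of_pos_right _ hδ)
      exact ⟨a.swap, ha, hlt.le⟩
  refine (distq_le_of_states hmem hd0 (fun ν => ?_) fun μ => ?_).trans_lt
    ((ENNReal.ofReal_lt_ofReal_iff (hd0.trans_lt hd)).2 hd)
  · obtain ⟨μ, hμ⟩ := hYX ν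
    exact ⟨μ, fun a b => by rw [abs_sub_comm]; exact hμ b a⟩
  · obtain ⟨ν, hν⟩ := hXY μ
    exact ⟨ν, fun a b => by rw [abs_sub_comm]; exact hν b a⟩

lemma diam_le_iff {D : ℝ} (hD : 0 ≤ D) :
    X.diam ≤ ENNReal.ofReal D ↔ ∀ (μ ν : StateSpace X.carrier) a, |μ a - ν a| ≤ D * X.lip a := by
  refine (@Metric.ediam_le_iff _ _ (rhoMetric X.lip) _).trans ?_
  simp only [Set.mem_univ, true_imp_iff]
  exact forall₂_congr fun μ ν => rho_le_iff hD

lemma exists_diam_le (X : CompactQuantumMetricSpace.{u}) :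
    ∃ D : ℝ, 0 ≤ D ∧ X.diam ≤ ENNReal.ofReal D := by
  obtain ⟨C, hC, h⟩ := X.isLipNorm.oscTotallyBounded.exists_bound
  exact ⟨C, hC, (diam_le_iff hC).2 fun μ ν a => h a μ ν⟩

/-- Go from one state of `X` to its match in `Y`, across `Y`, and back: the two crossings cost `ε`
each. -/
lemma diam_le_of_distq_lt {ε D : ℝ} (hε : 0 ≤ ε) (hD : 0 ≤ D) (h : distq X Y < ENNReal.ofReal ε)
    (hY : Y.diam ≤ ENNReal.ofReal D) : X.diam ≤ ENNReal.ofReal (D + 2 * ε) := by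
  obtain ⟨L, ⟨hL, hLX, hLY⟩, d, hd0, hd, hXY, -⟩ := exists_lipNorm_of_distq_lt h
  have hD' : 0 ≤ D + 2 * ε := by positivity
  refine (diam_le_iff hD').2 fun μ μ' a => hLX.le_of_forall hD' ?_
  rintro ⟨a', b⟩ rfl
  obtain ⟨ν, hν⟩ := hXY μ
  obtain ⟨ν', hν'⟩ := hXY μ'
  have h1 := hν a' b
  have h2 := hν' a' b
  have h3 := (diam_le_iff hD).1 hY ν ν' b
  have h4 := mul_le_mul_of_nonneg_left (hLY.apply_le (a', b)) hD
  have h5 := mul_le_mul_of_nonneg_right hd.le (apply_nonneg L (a', b))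
  simp only [LinearMap.fst_apply, LinearMap.snd_apply] at *
  rw [add_mul, mul_assoc]
  rw [abs_le] at *
  constructor <;> linarith

lemma scv_le_of_distq_lt {ε : ℝ} (h : distq X Y < ENNReal.ofReal ε) {N : ℕ}
    (f : Fin N → StateSpace Y.carrier)
    (hf : ∀ ν, ∃ i, rho Y.lip ν (f i) < ENNReal.ofReal ε) : X.scv (3 * ε) ≤ N := by
  classical
  obtain ⟨L, ⟨hL, hLX, hLY⟩, d, hd0, hd, hXY, hYX⟩ := exists_lipNorm_of_distq_lt h
  choose g hg using fun i => hYX (f i)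
  have hcard : (Finset.univ.image g).card ≤ N := Finset.card_image_le.trans (by simp)
  refine le_trans (iInf₂_le _ ⟨Finset.univ.image g, rfl, fun μ => ?_⟩) (Nat.cast_le.2 hcard)
  obtain ⟨ν, hν⟩ := hXY μ
  obtain ⟨i, hi⟩ := hf ν
  have hε : 0 < ε := hd0.trans_lt hd
  refine ⟨g i, Finset.mem_image_of_mem g (Finset.mem_univ i), ?_⟩
  have hD : 0 ≤ d + ε + d := by positivity
  refine ((rho_le_iff hD).2 fun a => hLX.le_of_forall hD ?_).trans_lt
    ((ENNReal.ofReal_lt_ofReal_iff (by positivity)).2 (show d + ε + d < 3 * ε by linarith))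
  rintro ⟨a', b⟩ rfl
  have h1 := hν a' b
  have h2 := hg i a' b
  have h3 := (rho_le_iff hε.le).1 hi.le b
  have h4 := mul_le_mul_of_nonneg_left (hLY.apply_le (a', b)) hε.le
  simp only [LinearMap.fst_apply, LinearMap.snd_apply] at *
  rw [add_mul, add_mul]
  rw [abs_le] at *
  constructor <;> linarith

/-- Restricting the elements of `X` to a finite set of states gives a finite-dimensional
quotient of `X`. -/
lemma exists_restriction (F : Finset (StateSpace X.carrier)) (hF : F.Nonempty) :
    ∃ (Y : CompactQuantumMetricSpace.{u}) (π : X.carrier →ₗ[ℝ] Y.carrier),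
      Module.rank ℝ Y.carrier ≤ F.card ∧ π unit = unit ∧ (∀ a, 0 ≤ a → 0 ≤ π a) ∧
      Induces X.lip π Y.lip ∧ ∀ μ ∈ F, ∃ ν : StateSpace Y.carrier, ∀ a, ν (π a) = μ a := by
  let r : X.carrier →ₗ[ℝ] (F → ℝ) := LinearMap.pi fun μ => μ.1.1
  have : Nonempty F := hF.to_subtype
  have hr1 : r unit = 1 := funext fun μ => μ.1.map_unit
  let p : Submodule ℝ (F → ℝ) := LinearMap.range r
  let inst : OrderUnitSpace p := OrderUnitSpace.ofFunctions p ⟨unit, hr1⟩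
  let π : X.carrier →ₗ[ℝ] p := r.rangeRestrict
  have hπ1 : π unit = unit := Subtype.ext hr1
  have hπ0 : ∀ a, 0 ≤ a → 0 ≤ π a := fun a ha μ => μ.1.map_nonneg ha
  obtain ⟨LB, hLB⟩ := exists_induces (π := π) X.lip r.surjective_rangeRestrict
  refine ⟨⟨p, LB, hLB.isLipNorm hπ1 hπ0 X.isLipNorm.oscTotallyBounded
    X.isLipNorm.map_unit_eq_zero⟩, π, ?_, hπ1, hπ0, hLB, fun μ hμ => ?_⟩
  · refine (Submodule.rank_le p).trans ?_
    rw [rank_fun', Fintype.card_coe]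
  · exact ⟨StateSpace.ofPositive
      ((LinearMap.proj (R := ℝ) (φ := fun _ : F => ℝ) ⟨μ, hμ⟩).comp p.subtype) rfl
      fun b hb => hb ⟨μ, hμ⟩, fun a => rfl⟩

/-- Restriction to a net is a bridge with no error in the elements, so the distance is governed by
how far states lie from the net. -/
lemma fin_le_scv (X : CompactQuantumMetricSpace.{u}) (ε : ℝ) : X.fin ε ≤ X.scv ε := by
  refine le_iInf₂ ?_
  rintro n ⟨F, rfl, hF⟩
  let := rhoMetric X.lip
  have := X.isLipNorm.compactSpace
  -- By compactness the distance to the net attains its maximum, which is strictly below `ε`. This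
  -- leaves room for a positive `γ` and keeps the same `ε` on both sides.
  obtain ⟨κ, -, hκ⟩ := (isCompact_univ (X := StateSpace X.carrier)).exists_isMaxOn
    Set.univ_nonempty
    (Metric.continuous_infEDist (s := (F : Set (StateSpace X.carrier)))).continuousOn
  have hlt : Metric.infEDist κ (F : Set (StateSpace X.carrier)) < ENNReal.ofReal ε := by
    obtain ⟨ν, hν, hlt⟩ := hF κ
    exact (Metric.infEDist_le_edist_of_mem hν).trans_lt hlt
  obtain ⟨r, hr, hrε⟩ := exists_between hlt
  have hrtop : r ≠ ∞ := (hrε.trans_le le_top).ne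
  have hrd : r = ENNReal.ofReal r.toReal := (ENNReal.ofReal_toReal hrtop).symm
  have hrε' : r.toReal < ε := ENNReal.toReal_lt_of_lt_ofReal hrε
  have hnear : ∀ μ : StateSpace X.carrier, ∃ ν ∈ F, ∀ a,
      |μ a - ν a| ≤ r.toReal * X.lip a := fun μ => by
    obtain ⟨ν, hν, hlt⟩ := Metric.infEDist_lt_iff.1 ((hκ (Set.mem_univ μ)).trans_lt hr)
    have hle : rho X.lip μ ν ≤ r := hlt.le
    rw [hrd] at hle
    exact ⟨ν, hν, (rho_le_iff ENNReal.toReal_nonneg).1 hle⟩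
  obtain ⟨ν₀, hν₀, -⟩ := hF κ
  obtain ⟨Y, π, hrank, hπ1, hπ0, hπ, hstates⟩ := exists_restriction F ⟨ν₀, hν₀⟩
  refine iInf₂_le _ ⟨Y, ?_, hrank⟩
  have hpos : 0 < (ε - r.toReal) / 2 := by linarith
  have hzero : orderUnitNorm (0 : Y.carrier) = 0 := map_zero (orderUnitSeminorm Y.carrier)
  refine (distq_le_of_bridge π hπ1 hpos ENNReal.toReal_nonneg (η := r.toReal)
    (fun a => ⟨π a, hπ.apply_le a, ?_⟩) (fun b δ hδ => ?_) (fun μ => ?_) fun ν => ?_).trans_lt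
    ((ENNReal.ofReal_lt_ofReal_iff (by linarith [ENNReal.toReal_nonneg (a := r)])).2
      (show r.toReal + (ε - r.toReal) / 2 < ε by linarith))
  · rw [sub_self, hzero]
    exact mul_nonneg hpos.le (apply_nonneg _ _)
  · obtain ⟨a, rfl, ha⟩ := hπ.exists_lt (lt_add_of_pos_right (Y.lip b) hδ)
    refine ⟨a, ha.le, ?_⟩
    rw [sub_self, hzero]
    exact mul_nonneg hpos.le (add_nonneg (apply_nonneg _ _) hδ.le)
  · obtain ⟨κ, hκ, h⟩ := hnear μ
    obtain ⟨ν, hν⟩ := hstates κ hκ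
    exact ⟨ν, fun a => by rw [hν]; exact h a⟩
  · refine ⟨StateSpace.comap π hπ1 hπ0 ν, fun a => ?_⟩
    rw [StateSpace.comap_apply, sub_self, abs_zero]
    exact mul_nonneg ENNReal.toReal_nonneg (apply_nonneg _ _)

lemma IsTotallyBounded.exists_diam_le {S : Set CompactQuantumMetricSpace.{u}}
    (h : IsTotallyBounded S) : ∃ D : ℝ≥0, ∀ X ∈ S, X.diam ≤ (D : ℝ≥0∞) := by
  obtain ⟨F, hF, hSF⟩ := h 1 one_pos
  choose d hd0 hd using CompactQuantumMetricSpace.exists_diam_le.{u}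
  obtain ⟨D, hD⟩ := (hF.image d).bddAbove
  refine ⟨Real.toNNReal (D + 2 * 1), fun X hX => ?_⟩
  obtain ⟨Y, hY, hXY⟩ := hSF X hX
  refine (diam_le_of_distq_lt zero_le_one (hd0 Y) hXY (hd Y)).trans
    (ENNReal.ofReal_le_ofReal ?_)
  linarith [hD (Set.mem_image_of_mem d hY)]

lemma IsTotallyBounded.exists_scv_le {S : Set CompactQuantumMetricSpace.{u}}
    (h : IsTotallyBounded S) {ε : ℝ} (hε : 0 < ε) :
    ∃ N : ℕ+, ∀ X ∈ S, X.scv ε ≤ ((N : ℕ) : ℕ∞) := by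
  have hpos : 0 < ε / 3 := by positivity
  obtain ⟨F, hF, hSF⟩ := h (ε / 3) hpos
  choose n f hf using fun Y : CompactQuantumMetricSpace.{u} => Y.isLipNorm.exists_finite_cover hpos
  obtain ⟨N, hN⟩ := (hF.image n).bddAbove
  refine ⟨N.succPNat, fun X hX => ?_⟩
  obtain ⟨Y, hY, hXY⟩ := hSF X hX
  have := scv_le_of_distq_lt hXY (f Y) (hf Y)
  rw [mul_div_cancel₀ ε three_ne_zero] at this
  refine this.trans (Nat.cast_le.2 ?_)
  exact (hN (Set.mem_image_of_mem n hY)).trans (Nat.le_succ N)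

end CompactQuantumMetricSpace

/-! ### Auerbach bases. -/

/-- Auerbach's lemma. -/
lemma exists_auerbach_basis (E : Type*) [NormedAddCommGroup E] [NormedSpace ℝ E]
    [FiniteDimensional ℝ E] : ∃ b : Module.Basis (Fin (Module.finrank ℝ E)) ℝ E,
      (∀ i, ‖b i‖ ≤ 1) ∧ ∀ x i, |b.repr x i| ≤ ‖x‖ := by
  let e := Module.finBasis ℝ E
  have := FiniteDimensional.proper_real E
  let K : Set (Fin (Module.finrank ℝ E) → E) := Set.univ.pi fun _ => Metric.closedBall 0 1
  have hK : IsCompact K := isCompact_univ_pi fun _ => isCompact_closedBall 0 1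
  have hcont : Continuous fun v : Fin (Module.finrank ℝ E) → E => |e.det v| := by
    simp only [Module.Basis.det_apply]
    refine (Continuous.matrix_det (continuous_matrix fun i j => ?_)).abs
    simp only [Module.Basis.toMatrix_apply]
    exact (LinearMap.continuous_of_finiteDimensional (e.coord i)).comp (continuous_apply j)
  obtain ⟨v, hv, hmax⟩ := hK.exists_isMaxOn ⟨0, fun _ _ => by simp⟩ hcont.continuousOn
  -- The normalized reference basis competes in the maximization and has nonzero determinant.
  have hdet : e.det v ≠ 0 := by
    let w : Fin (Module.finrank ℝ E) → E := fun i => ‖e i‖⁻¹ • e i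
    have hw : w ∈ K := fun i _ => by
      rw [mem_closedBall_zero_iff, norm_smul, norm_inv, norm_norm,
        inv_mul_cancel₀ (norm_ne_zero_iff.2 (e.ne_zero i))]
    have hdw : e.det w ≠ 0 := by
      have : e.det w = (∏ i, ‖e i‖⁻¹) • e.det e := AlternatingMap.map_smul_univ _ _ _
      rw [this, e.det_self, smul_eq_mul, mul_one]
      exact Finset.prod_ne_zero_iff.2 fun i _ => inv_ne_zero (norm_ne_zero_iff.2 (e.ne_zero i))
    exact abs_pos.1 ((abs_pos.2 hdw).trans_le (hmax hw))
  obtain ⟨hli, hsp⟩ := e.is_basis_iff_det.2 (isUnit_iff_ne_zero.2 hdet)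
  let b := Module.Basis.mk hli hsp.ge
  refine ⟨b, fun i => ?_, fun x i => ?_⟩
  · rw [Module.Basis.mk_apply]
    exact mem_closedBall_zero_iff.1 (hv i trivial)
  · have hunit : ∀ y, ‖y‖ ≤ 1 → |b.repr y i| ≤ 1 := by
      intro y hy
      -- Cramer's rule: by maximality, replacing one vector by a point of the unit ball cannot
      -- increase the determinant, so the coordinate is at most `1`.
      have h1 : e.det v * b.repr y i = e.det (Function.update v i y) :=
        LinearMap.congr_fun (e.det_smul_mk_coord_eq_det_update hli hsp.ge i) y
      have h2 : Function.update v i y ∈ K := fun j _ => by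
        rw [mem_closedBall_zero_iff]
        rcases eq_or_ne j i with rfl | hj
        · rwa [Function.update_self]
        · rw [Function.update_of_ne hj]
          exact mem_closedBall_zero_iff.1 (hv j trivial)
      have h3 : |e.det (Function.update v i y)| ≤ |e.det v| := hmax h2
      rw [← h1, abs_mul] at h3
      exact le_of_mul_le_mul_left (by rwa [mul_one]) (abs_pos.2 hdet)
    rcases eq_or_ne x 0 with rfl | hx
    · simp
    · have hx' := norm_pos_iff.2 hx
      have := hunit (‖x‖⁻¹ • x) (by
        rw [norm_smul, norm_inv, norm_norm, inv_mul_cancel₀ hx'.ne'])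
      rwa [map_smul, Finsupp.smul_apply, smul_eq_mul, abs_mul, abs_inv, abs_norm,
        inv_mul_le_iff₀ hx', mul_one] at this

lemma Seminorm.exists_auerbach_basis {V : Type*} [AddCommGroup V] [Module ℝ V]
    [FiniteDimensional ℝ V] (L : Seminorm ℝ V) (hL : ∀ x, L x = 0 → x = 0) :
    ∃ b : Module.Basis (Fin (Module.finrank ℝ V)) ℝ V,
      (∀ i, L (b i) ≤ 1) ∧ ∀ x i, |b.repr x i| ≤ L x := by
  let : Norm V := ⟨L⟩
  have core : NormedSpace.Core ℝ V :=
    { norm_nonneg := apply_nonneg L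
      norm_smul := map_smul_eq_mul L
      norm_triangle := map_add_le_add L
      norm_eq_zero_iff := fun x => ⟨hL x, fun h => h ▸ map_zero L⟩ }
  let : NormedAddCommGroup V := NormedAddCommGroup.ofCore core
  let : NormedSpace ℝ V := NormedSpace.ofCore core
  exact _root_.exists_auerbach_basis V

/-! ### Charts of finite-dimensional spaces modulo the unit. -/

namespace CompactQuantumMetricSpace

/-- Coordinates on a finite-dimensional compact quantum metric space modulo the order unit in
which the unit ball of the Lip-norm lies between the unit balls of `ℓ¹` and `ℓ^∞`. -/
structure AuerbachChart (X : CompactQuantumMetricSpace.{u}) (k : ℕ) where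
  base : StateSpace X.carrier
  lin : (Fin k → ℝ) →ₗ[ℝ] X.carrier
  coord : X.carrier →ₗ[ℝ] (Fin k → ℝ)
  base_lin : ∀ c, base (lin c) = 0
  coord_lin : ∀ c, coord (lin c) = c
  decomp : ∀ a, base a • unit + lin (coord a) = a
  lip_lin_le : ∀ c, X.lip (lin c) ≤ ∑ i, |c i|
  abs_coord_le : ∀ a i, |coord a i| ≤ X.lip a

lemma lip_smul_unit_add (X : CompactQuantumMetricSpace.{u}) (t : ℝ) (a : X.carrier) :
    X.lip (t • unit + a) = X.lip a := by
  have h0 : ∀ s : ℝ, X.lip (s • unit) = 0 := fun s => (X.isLipNorm.eq_zero_iff _).2 ⟨s, rfl⟩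
  refine le_antisymm ?_ ?_
  · have := map_add_le_add X.lip (t • unit) a
    rwa [h0, zero_add] at this
  · have := map_add_le_add X.lip ((-t) • unit) (t • unit + a)
    rwa [h0, zero_add, neg_smul, neg_add_cancel_left] at this

/-- The kernel of a state complements the line of the unit, and the Lip-norm is a genuine norm on
it; the chart comes from an Auerbach basis of this kernel. -/
lemma exists_auerbachChart (X : CompactQuantumMetricSpace.{u}) {n : ℕ}
    (hn : Module.rank ℝ X.carrier ≤ n) : ∃ k < n + 1, Nonempty (AuerbachChart X k) := by
  have : FiniteDimensional ℝ X.carrier :=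
    Module.rank_lt_aleph0_iff.1 (hn.trans_lt (Cardinal.natCast_lt_aleph0))
  let μ : StateSpace X.carrier := Classical.arbitrary _
  let V : Submodule ℝ X.carrier := LinearMap.ker μ.1
  obtain ⟨b, hb1, hb⟩ := (X.lip.comp V.subtype).exists_auerbach_basis (by
    rintro ⟨x, hx⟩ h
    obtain ⟨t, rfl⟩ := (X.isLipNorm.eq_zero_iff x).1 h
    have : t = 0 := (μ.map_smul_unit t).symm.trans hx
    exact Subtype.ext (by simp [this]))
  let P : X.carrier →ₗ[ℝ] V := LinearMap.codRestrict V
    (LinearMap.id - μ.1.smulRight unit) fun a => by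
      change μ (a - μ a • unit) = 0
      rw [map_sub, μ.map_smul_unit, sub_self]
  have hP : ∀ a, (P a : X.carrier) = a - μ a • unit := fun a => rfl
  have hPV : ∀ x : V, P x = x := fun x => Subtype.ext (by
    have : μ x = 0 := x.2
    rw [hP, this, zero_smul, sub_zero])
  have hk : Module.finrank ℝ V < n + 1 := by
    have h1 := Submodule.finrank_le V
    have h2 : Module.finrank ℝ X.carrier ≤ n := Module.finrank_le_of_rank_le hn
    omega
  refine ⟨_, hk, ⟨μ, V.subtype.comp b.equivFun.symm.toLinearMap,
    b.equivFun.toLinearMap.comp P, fun c => (b.equivFun.symm c).2, fun c => ?_, fun a => ?_,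
    fun c => ?_, fun a i => ?_⟩⟩
  · change b.equivFun (P (b.equivFun.symm c : X.carrier)) = c
    rw [hPV, LinearEquiv.apply_symm_apply]
  · change μ a • unit + ((b.equivFun.symm (b.equivFun (P a)) : V) : X.carrier) = a
    rw [LinearEquiv.symm_apply_apply, hP, add_sub_cancel]
  · change (X.lip.comp V.subtype) (b.equivFun.symm c) ≤ _
    rw [Module.Basis.equivFun_symm_apply]
    refine (Finset.le_sum_of_subadditive _ (map_zero _).le (map_add_le_add _) _ _).trans
      (Finset.sum_le_sum fun i _ => ?_)
    rw [map_smul_eq_mul, Real.norm_eq_abs]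
    exact mul_le_of_le_one_right (abs_nonneg _) (hb1 i)
  · refine (hb (P a) i).trans_eq ?_
    change X.lip (P a) = X.lip a
    rw [hP, sub_eq_neg_add, ← neg_smul, lip_smul_unit_add]

namespace AuerbachChart

variable {X Y : CompactQuantumMetricSpace.{u}} {k : ℕ} (cX : AuerbachChart X k)
  (cY : AuerbachChart Y k)

lemma coord_unit : cX.coord unit = 0 := by
  have := cX.decomp unit
  rw [StateSpace.map_unit, one_smul, add_eq_left] at this
  rw [← cX.coord_lin (cX.coord unit), this, map_zero]

lemma lip_eq (a : X.carrier) : X.lip a = X.lip (cX.lin (cX.coord a)) := by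
  conv_lhs => rw [← cX.decomp a]
  exact X.lip_smul_unit_add _ _

lemma orderUnitNorm_lin_le {D : ℝ} (hD : 0 ≤ D) (hX : X.diam ≤ ENNReal.ofReal D)
    (c : Fin k → ℝ) : orderUnitNorm (cX.lin c) ≤ D * X.lip (cX.lin c) := by
  refine StateSpace.orderUnitNorm_le_iff_forall.2 fun μ => ?_
  have := (diam_le_iff hD).1 hX μ cX.base (cX.lin c)
  rwa [cX.base_lin, sub_zero] at this

lemma abs_apply_lin_single_le {D : ℝ} (hD : 0 ≤ D) (hX : X.diam ≤ ENNReal.ofReal D)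
    (μ : StateSpace X.carrier) (i : Fin k) : |μ (cX.lin (Pi.single i 1))| ≤ D := by
  refine (μ.abs_apply_le _).trans ((cX.orderUnitNorm_lin_le hD hX _).trans ?_)
  refine mul_le_of_le_one_right hD ((cX.lip_lin_le _).trans_eq ?_)
  rw [Finset.sum_eq_single i] <;> simp +contextual

lemma apply_lin (μ : StateSpace X.carrier) (c : Fin k → ℝ) :
    μ (cX.lin c) = ∑ i, c i * μ (cX.lin (Pi.single i 1)) := by
  exact LinearMap.pi_apply_eq_sum_univ (μ.1.comp cX.lin) c |>.trans (by
    refine Finset.sum_congr rfl fun i _ => ?_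
    rw [smul_eq_mul, LinearMap.comp_apply]
    congr 4
    ext j
    simp [Pi.single_apply, eq_comm])

/-- Spaces having charts with close Lip-norms and close state spaces are close. -/
lemma distq_le {D κ η γ : ℝ} (hD : 0 ≤ D) (hY : Y.diam ≤ ENNReal.ofReal D) (hκ : 0 ≤ κ)
    (hη : 0 ≤ η) (hγ : 0 < γ) (hκγ : κ * D ≤ γ)
    (hLY : ∀ c, Y.lip (cY.lin c) ≤ (1 + κ) * X.lip (cX.lin c))
    (hLX : ∀ c, X.lip (cX.lin c) ≤ (1 + κ) * Y.lip (cY.lin c))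
    (hXY : ∀ μ : StateSpace X.carrier, ∃ ν : StateSpace Y.carrier, ∀ i,
      |μ (cX.lin (Pi.single i 1)) - ν (cY.lin (Pi.single i 1))| ≤ η)
    (hYX : ∀ ν : StateSpace Y.carrier, ∃ μ : StateSpace X.carrier, ∀ i,
      |μ (cX.lin (Pi.single i 1)) - ν (cY.lin (Pi.single i 1))| ≤ η) :
    distq X Y ≤ ENNReal.ofReal (k * η + γ) := by
  -- `T` keeps the base value and the chart coordinates.
  let T : X.carrier →ₗ[ℝ] Y.carrier := cX.base.1.smulRight unit + cY.lin.comp cX.coord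
  have hT : ∀ a, T a = cX.base a • unit + cY.lin (cX.coord a) := fun a => rfl
  have hpos : 0 < 1 + κ := by positivity
  have hnn : 0 ≤ (1 + κ)⁻¹ := inv_nonneg.2 hpos.le
  have hdiff : 1 - (1 + κ)⁻¹ = κ * (1 + κ)⁻¹ := by field_simp; ring
  have hdiff0 : 0 ≤ 1 - (1 + κ)⁻¹ := hdiff ▸ mul_nonneg hκ hnn
  have key : ∀ (μ : StateSpace X.carrier) (ν : StateSpace Y.carrier),
      (∀ i, |μ (cX.lin (Pi.single i 1)) - ν (cY.lin (Pi.single i 1))| ≤ η) →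
      ∀ a, |μ a - ν (T a)| ≤ k * η * X.lip a := by
    intro μ ν h a
    have h1 : μ a - ν (T a) = ∑ i, cX.coord a i *
        (μ (cX.lin (Pi.single i 1)) - ν (cY.lin (Pi.single i 1))) := by
      have h2 : μ (cX.base a • unit + cX.lin (cX.coord a)) =
          cX.base a + μ (cX.lin (cX.coord a)) := by rw [map_add, μ.map_smul_unit]
      rw [cX.decomp] at h2
      rw [h2, hT, map_add, ν.map_smul_unit, cX.apply_lin, cY.apply_lin, add_sub_add_left_eq_sub,
        ← Finset.sum_sub_distrib]
      simp only [mul_sub]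
    rw [h1]
    calc |∑ i, cX.coord a i * (μ (cX.lin (Pi.single i 1)) - ν (cY.lin (Pi.single i 1)))|
        ≤ ∑ i, |cX.coord a i * (μ (cX.lin (Pi.single i 1)) - ν (cY.lin (Pi.single i 1)))| :=
          Finset.abs_sum_le_sum_abs _ _
      _ ≤ ∑ _i : Fin k, X.lip a * η := Finset.sum_le_sum fun i _ => by
          rw [abs_mul]
          exact mul_le_mul (cX.abs_coord_le a i) (h i) (abs_nonneg _) (apply_nonneg _ _)
      _ = k * η * X.lip a := by
          rw [Finset.sum_const, Finset.card_univ, Fintype.card_fin, nsmul_eq_mul]; ring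
  have hnorm : ∀ (t : ℝ) (c : Fin k → ℝ), |t| = 1 - (1 + κ)⁻¹ →
      orderUnitNorm (t • cY.lin c) ≤ (1 - (1 + κ)⁻¹) * (D * Y.lip (cY.lin c)) := fun t c ht => by
    have : orderUnitNorm (t • cY.lin c) = |t| * orderUnitNorm (cY.lin c) :=
      map_smul_eq_mul (orderUnitSeminorm Y.carrier) t _
    rw [this, ht]
    exact mul_le_mul_of_nonneg_left (cY.orderUnitNorm_lin_le hD hY c) hdiff0
  refine distq_le_of_bridge T ?_ hγ (by positivity) (fun a => ?_) (fun b δ hδ => ?_)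
    (fun μ => ?_) fun ν => ?_
  · rw [hT, cX.coord_unit, map_zero, add_zero, StateSpace.map_unit, one_smul]
  -- Shrinking the part off the unit by `1 + κ` restores the Lip bound; the diameter bounds the
  -- resulting error in norm.
  · refine ⟨cX.base a • unit + (1 + κ)⁻¹ • cY.lin (cX.coord a), ?_, ?_⟩
    · rw [lip_smul_unit_add, map_smul_eq_mul, Real.norm_of_nonneg hnn, inv_mul_le_iff₀ hpos,
        cX.lip_eq a]
      exact hLY _
    · have h1 : T a - (cX.base a • unit + (1 + κ)⁻¹ • cY.lin (cX.coord a)) =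
          (1 - (1 + κ)⁻¹) • cY.lin (cX.coord a) := by
        rw [hT, add_sub_add_left_eq_sub, sub_smul, one_smul]
      rw [h1]
      refine (hnorm _ _ (abs_of_nonneg hdiff0)).trans ?_
      have h2 := mul_le_mul_of_nonneg_left (hLY (cX.coord a)) hD
      rw [← cX.lip_eq] at h2
      calc _ ≤ (1 - (1 + κ)⁻¹) * (D * ((1 + κ) * X.lip a)) :=
            mul_le_mul_of_nonneg_left h2 hdiff0
        _ = κ * D * X.lip a := by rw [hdiff]; field_simp
        _ ≤ γ * X.lip a := mul_le_mul_of_nonneg_right hκγ (apply_nonneg _ _)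
  · refine ⟨cY.base b • unit + (1 + κ)⁻¹ • cX.lin (cY.coord b), ?_, ?_⟩
    · refine le_trans ?_ (le_add_of_nonneg_right hδ.le)
      rw [lip_smul_unit_add, map_smul_eq_mul, Real.norm_of_nonneg hnn, inv_mul_le_iff₀ hpos,
        cY.lip_eq b]
      exact hLX _
    · have h1 : T (cY.base b • unit + (1 + κ)⁻¹ • cX.lin (cY.coord b)) - b =
          ((1 + κ)⁻¹ - 1) • cY.lin (cY.coord b) := by
        have h2 : T (cY.base b • unit + (1 + κ)⁻¹ • cX.lin (cY.coord b)) =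
            cY.base b • unit + (1 + κ)⁻¹ • cY.lin (cY.coord b) := by
          rw [hT, map_add, StateSpace.map_smul_unit, map_smul, cX.base_lin, map_add, map_smul,
            map_smul, cX.coord_unit, cX.coord_lin, smul_zero, smul_zero, zero_add, add_zero,
            map_smul]
        have h3 := congrArg (T (cY.base b • unit + (1 + κ)⁻¹ • cX.lin (cY.coord b)) - ·)
          (cY.decomp b)
        beta_reduce at h3
        rw [← h3, h2, add_sub_add_left_eq_sub, sub_smul, one_smul]
      rw [h1]
      refine (hnorm _ _ (by rw [abs_sub_comm, abs_of_nonneg hdiff0])).trans ?_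
      rw [← cY.lip_eq]
      have h2 : (1 - (1 + κ)⁻¹) * D ≤ γ := by
        refine le_trans (mul_le_mul_of_nonneg_right ?_ hD) hκγ
        rw [hdiff]
        exact mul_le_of_le_one_right hκ (inv_le_one_of_one_le₀ (by linarith))
      rw [← mul_assoc]
      exact mul_le_mul h2 (le_add_of_nonneg_right hδ.le) (apply_nonneg _ _) hγ.le
  · obtain ⟨ν, hν⟩ := hXY μ
    exact ⟨ν, key μ ν hν⟩
  · obtain ⟨μ, hμ⟩ := hYX ν
    exact ⟨μ, key μ ν hμ⟩

end AuerbachChart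

end CompactQuantumMetricSpace

/-! ### Finitely many classes at each scale, and the converse. -/

namespace CompactQuantumMetricSpace

namespace AuerbachChart

variable {X Y : CompactQuantumMetricSpace.{u}} {k : ℕ} (cX : AuerbachChart X k)
  (cY : AuerbachChart Y k)

lemma lip_lin_le_of_abs_le {δ : ℝ} {c : Fin k → ℝ} (hc : ∀ i, |c i| ≤ δ) :
    X.lip (cX.lin c) ≤ k * δ := by
  refine (cX.lip_lin_le c).trans ((Finset.sum_le_sum fun i _ => hc i).trans_eq ?_)
  rw [Finset.sum_const, Finset.card_univ, Fintype.card_fin, nsmul_eq_mul]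

lemma lip_lin_sub_le {δ : ℝ} {c c' : Fin k → ℝ} (hc : ∀ i, |c i - c' i| ≤ δ) :
    X.lip (cX.lin c) ≤ X.lip (cX.lin c') + k * δ := by
  have h1 := map_add_le_add X.lip (cX.lin c') (cX.lin (c - c'))
  rw [← map_add, add_sub_cancel] at h1
  have h2 := cX.lip_lin_le_of_abs_le (c := c - c') hc
  linarith

/-- Normalizing the Lip-norm of `X` to `1` puts the coordinates in the unit cube, so an additive
error there becomes a multiplicative one everywhere. -/
lemma lip_lin_le_one_add_mul {κ : ℝ}
    (h : ∀ c : Fin k → ℝ, (∀ i, |c i| ≤ 1) → Y.lip (cY.lin c) ≤ X.lip (cX.lin c) + κ)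
    (c : Fin k → ℝ) : Y.lip (cY.lin c) ≤ (1 + κ) * X.lip (cX.lin c) := by
  have hc : ∀ i, |c i| ≤ X.lip (cX.lin c) := fun i => by
    have := cX.abs_coord_le (cX.lin c) i
    rwa [cX.coord_lin] at this
  rcases (apply_nonneg X.lip (cX.lin c)).eq_or_lt with h0 | hpos
  · have : c = 0 := funext fun i => abs_nonpos_iff.1 ((hc i).trans_eq h0.symm)
    simp [this]
  · have h1 := h ((X.lip (cX.lin c))⁻¹ • c) fun i => by
      rw [Pi.smul_apply, smul_eq_mul, abs_mul, abs_inv, abs_of_pos hpos, inv_mul_le_iff₀ hpos,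
        mul_one]
      exact hc i
    rw [map_smul cY.lin, map_smul cX.lin, map_smul_eq_mul, map_smul_eq_mul, norm_inv,
      Real.norm_of_nonneg hpos.le, inv_mul_cancel₀ hpos.ne', inv_mul_le_iff₀ hpos] at h1
    linarith

/-- The charts of `k + 1`-dimensional spaces of diameter at most `D` fall into finitely many
classes of diameter at most `ε`. -/
lemma exists_finite_classes (k : ℕ) {D ε : ℝ} (hD : 0 ≤ D) (hε : 0 < ε) :
    ∃ (ι : Type) (_ : Finite ι) (Ψ : ∀ X : CompactQuantumMetricSpace.{u}, AuerbachChart X k → ι),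
      ∀ (X Y : CompactQuantumMetricSpace.{u}) (cX : AuerbachChart X k) (cY : AuerbachChart Y k),
        X.diam ≤ ENNReal.ofReal D → Y.diam ≤ ENNReal.ofReal D → Ψ X cX = Ψ Y cY →
        distq X Y ≤ ENNReal.ofReal ε := by
  classical
  -- This is `k η + γ` with `η = δ`, `κ = (2k + 1) δ` and `γ = κ D + δ`; the last `δ` keeps `γ`
  -- positive even if `D = 0`.
  obtain ⟨δ, hδ, hδε⟩ : ∃ δ : ℝ, 0 < δ ∧ k * δ + ((2 * k + 1) * δ * D + δ) = ε := by
    refine ⟨ε / (k + ((2 * k + 1) * D + 1)), by positivity, ?_⟩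
    field_simp
  obtain ⟨n, φ, hφ⟩ := exists_interval_cells 1 hδ
  obtain ⟨m, ψ, hψ⟩ := exists_interval_cells k hδ
  obtain ⟨l, χ, hχ⟩ := exists_interval_cells D hδ
  have hrep : ∀ q : Fin k → Fin (n + 1), ∃ c : Fin k → ℝ, (∀ i, |c i| ≤ 1) ∧
      ∀ c' : Fin k → ℝ, (∀ i, |c' i| ≤ 1) → (fun i => φ (c' i)) = q → ∀ i, |c' i - c i| ≤ δ := by
    intro q
    by_cases hq : ∃ c : Fin k → ℝ, (∀ i, |c i| ≤ 1) ∧ (fun i => φ (c i)) = q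
    · obtain ⟨c, hc, rfl⟩ := hq
      exact ⟨c, hc, fun c' hc' h i => hφ _ _ (hc' i) (hc i) (congrFun h i)⟩
    · exact ⟨0, by simp, fun c' hc' h => (hq ⟨c', hc', h⟩).elim⟩
  choose rep hrep1 hrepδ using hrep
  -- The record: rounded Lip-norms of the cube representatives, and the set of cells that contain a
  -- state.
  refine ⟨((Fin k → Fin (n + 1)) → Fin (m + 1)) × Set (Fin k → Fin (l + 1)), inferInstance,
    fun X cX => (fun q => ψ (X.lip (cX.lin (rep q))),
      {q | ∃ μ : StateSpace X.carrier, (fun i => χ (μ (cX.lin (Pi.single i 1)))) = q}), ?_⟩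
  intro X Y cX cY hX hY hXY
  obtain ⟨h1, h2⟩ := Prod.mk.inj hXY
  have hk : ∀ (X : CompactQuantumMetricSpace.{u}) (cX : AuerbachChart X k) q,
      |X.lip (cX.lin (rep q))| ≤ k := fun X cX q => by
    rw [abs_of_nonneg (apply_nonneg _ _)]
    simpa using cX.lip_lin_le_of_abs_le (hrep1 q)
  have hclose : ∀ q, |X.lip (cX.lin (rep q)) - Y.lip (cY.lin (rep q))| ≤ δ := fun q =>
    hψ _ _ (hk X cX q) (hk Y cY q) (congrFun h1 q)
  have hstates : ∀ (μ : StateSpace X.carrier) (ν : StateSpace Y.carrier),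
      (fun i => χ (μ (cX.lin (Pi.single i 1)))) = (fun i => χ (ν (cY.lin (Pi.single i 1)))) →
      ∀ i, |μ (cX.lin (Pi.single i 1)) - ν (cY.lin (Pi.single i 1))| ≤ δ := fun μ ν h i =>
    hχ _ _ (cX.abs_apply_lin_single_le hD hX μ i) (cY.abs_apply_lin_single_le hD hY ν i)
      (congrFun h i)
  rw [← hδε]
  refine cX.distq_le cY (κ := (2 * k + 1) * δ) hD hY (by positivity) hδ.le (by positivity)
    (by linarith) (cX.lip_lin_le_one_add_mul cY fun c hc => ?_)
    (cY.lip_lin_le_one_add_mul cX fun c hc => ?_) (fun μ => ?_) fun ν => ?_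
  -- Moving to the representative and back costs `k δ` each way and rounding costs `δ`, which is
  -- where `2k + 1` comes from.
  · have e1 := hrepδ _ c hc rfl
    have e2 := cY.lip_lin_sub_le e1
    have e3 := cX.lip_lin_sub_le fun i => (abs_sub_comm _ _).trans_le (e1 i)
    have e4 := (abs_le.1 (hclose fun i => φ (c i))).1
    linarith
  · have e1 := hrepδ _ c hc rfl
    have e2 := cX.lip_lin_sub_le e1
    have e3 := cY.lip_lin_sub_le fun i => (abs_sub_comm _ _).trans_le (e1 i)
    have e4 := (abs_le.1 (hclose fun i => φ (c i))).2
    linarith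
  · obtain ⟨ν, hν⟩ := (Set.ext_iff.1 h2 _).1 ⟨μ, rfl⟩
    exact ⟨ν, hstates μ ν hν.symm⟩
  · obtain ⟨μ, hμ⟩ := (Set.ext_iff.1 h2 _).2 ⟨ν, rfl⟩
    exact ⟨μ, hstates μ ν hμ⟩

end AuerbachChart

lemma exists_rank_le_of_fin_le {X : CompactQuantumMetricSpace.{u}} {ε : ℝ} {n : ℕ}
    (h : X.fin ε ≤ n) : ∃ Y : CompactQuantumMetricSpace.{u},
      distq X Y < ENNReal.ofReal ε ∧ Module.rank ℝ Y.carrier ≤ n := by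
  -- A strict bound by `n + 1` extracts a witness from the infimum, and integrality brings it back
  -- to `n`.
  have h1 : X.fin ε < ((n + 1 : ℕ) : ℕ∞) := h.trans_lt (Nat.cast_lt.2 n.lt_succ_self)
  obtain ⟨m, hm⟩ := iInf_lt_iff.1 h1
  obtain ⟨⟨Y, hXY, hY⟩, hmn⟩ := iInf_lt_iff.1 hm
  exact ⟨Y, hXY, hY.trans (Nat.cast_le.2 (Nat.lt_succ_iff.1 (Nat.cast_lt.1 hmn)))⟩

/-- The spaces of bounded dimension and bounded diameter are totally bounded. -/
lemma exists_finite_classes (n : ℕ) {D ε : ℝ} (hD : 0 ≤ D) (hε : 0 < ε) :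
    ∃ (ι : Type) (_ : Finite ι) (Ψ : CompactQuantumMetricSpace.{u} → ι),
      ∀ X Y : CompactQuantumMetricSpace.{u},
        Module.rank ℝ X.carrier ≤ n → Module.rank ℝ Y.carrier ≤ n →
        X.diam ≤ ENNReal.ofReal D → Y.diam ≤ ENNReal.ofReal D → Ψ X = Ψ Y →
        distq X Y ≤ ENNReal.ofReal ε := by
  classical
  choose ι hι Ψ hΨ using fun k => AuerbachChart.exists_finite_classes.{u} k hD hε
  let Φ : CompactQuantumMetricSpace.{u} → Option (Σ k : Fin (n + 1), ι k) := fun X =>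
    if h : ∃ k : Fin (n + 1), Nonempty (AuerbachChart X k) then
      some ⟨h.choose, Ψ _ X h.choose_spec.some⟩
    else none
  have hΦ : ∀ X : CompactQuantumMetricSpace.{u}, Module.rank ℝ X.carrier ≤ n →
      ∃ (k : Fin (n + 1)) (c : AuerbachChart X k), Φ X = some ⟨k, Ψ k X c⟩ := fun X hX => by
    have h : ∃ k : Fin (n + 1), Nonempty (AuerbachChart X k) := by
      obtain ⟨k, hk, hc⟩ := X.exists_auerbachChart hX
      exact ⟨⟨k, hk⟩, hc⟩
    exact ⟨h.choose, h.choose_spec.some, dif_pos h⟩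
  refine ⟨_, inferInstance, Φ, fun X Y hX hY hXD hYD hXY => ?_⟩
  obtain ⟨k, cX, hkX⟩ := hΦ X hX
  obtain ⟨k', cY, hkY⟩ := hΦ Y hY
  rw [hkX, hkY, Option.some_inj, Sigma.mk.injEq] at hXY
  obtain ⟨rfl, h⟩ := hXY
  exact hΨ k X Y cX cY hXD hYD (eq_of_heq h)

lemma isTotallyBounded_of_diam_le_of_fin_le {S : Set CompactQuantumMetricSpace.{u}} {D : ℝ≥0}
    (hD : ∀ X ∈ S, X.diam ≤ (D : ℝ≥0∞))
    (hfin : ∀ ε : ℝ, 0 < ε → ∃ n : ℕ, ∀ X ∈ S, X.fin ε ≤ n) : IsTotallyBounded S := by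
  intro ε hε
  have hpos : 0 < ε / 2 := by positivity
  obtain ⟨n, hn⟩ := hfin (ε / 2) hpos
  choose Y hXY hY using fun X : S => exists_rank_le_of_fin_le (hn X X.2)
  -- The approximants need not belong to `S`, so their diameter bound is derived from closeness.
  have hdiam : ∀ X, (Y X).diam ≤ ENNReal.ofReal (D + 2 * (ε / 2)) := fun X =>
    diam_le_of_distq_lt hpos.le D.2 (distq_comm_lt (hXY X))
      ((hD X X.2).trans_eq (ENNReal.ofReal_coe_nnreal).symm)
  obtain ⟨ι, _, Ψ, hΨ⟩ := exists_finite_classes.{u} n (D := D + 2 * (ε / 2)) (by positivity)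
    (show 0 < ε / 4 by positivity)
  -- One approximant is kept for each class that occurs.
  have hsel : ∀ i : Set.range (fun X => Ψ (Y X)), ∃ X, Ψ (Y X) = i := fun i => i.2
  choose sel hsel using hsel
  refine ⟨Set.range fun i => Y (sel i), Set.finite_range _, fun X hX => ?_⟩
  let i : Set.range (fun X => Ψ (Y X)) := ⟨Ψ (Y ⟨X, hX⟩), ⟨X, hX⟩, rfl⟩
  refine ⟨_, ⟨i, rfl⟩, ?_⟩
  have h1 := hΨ (Y ⟨X, hX⟩) (Y (sel i)) (hY _) (hY _) (hdiam _) (hdiam _) (hsel i).symm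
  have h2 : distq (Y ⟨X, hX⟩) (Y (sel i)) < ENNReal.ofReal (ε / 2) :=
    h1.trans_lt ((ENNReal.ofReal_lt_ofReal_iff hpos).2 (by linarith))
  have := distq_lt_add (hXY ⟨X, hX⟩) h2
  rwa [add_halves] at this

end CompactQuantumMetricSpace

end

theorem theorem13p5 (S : Set CompactQuantumMetricSpace.{u}) :
    (CompactQuantumMetricSpace.IsTotallyBounded S →
      (∃ D : ℝ≥0, ∀ X ∈ S, X.diam ≤ (D : ℝ≥0∞)) ∧
      (∃ G : Set.Ioi (0 : ℝ) → ℕ+, ∀ X ∈ S, ∀ ε : Set.Ioi (0 : ℝ),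
        X.scv ε ≤ ((G ε : ℕ) : ℕ∞) ∧ X.fin ε ≤ X.scv ε)) ∧
    ((∃ D : ℝ≥0, ∀ X ∈ S, X.diam ≤ (D : ℝ≥0∞)) →
      (∃ G : Set.Ioi (0 : ℝ) → ℕ+, ∀ X ∈ S, ∀ ε : Set.Ioi (0 : ℝ),
        X.fin ε ≤ ((G ε : ℕ) : ℕ∞)) →
      CompactQuantumMetricSpace.IsTotallyBounded S) := by
  refine ⟨fun h => ⟨h.exists_diam_le, ?_⟩, ?_⟩
  · choose G hG using fun ε : Set.Ioi (0 : ℝ) => h.exists_scv_le ε.2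
    exact ⟨G, fun X hX ε => ⟨hG ε X hX, X.fin_le_scv ε⟩⟩
  · rintro ⟨D, hD⟩ ⟨G, hG⟩
    exact CompactQuantumMetricSpace.isTotallyBounded_of_diam_le_of_fin_le hD
      fun ε hε => ⟨G ⟨ε, hε⟩, fun X hX => hG X hX ⟨ε, hε⟩⟩
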